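/- **The model.** For $x=(x_1,\dots,x_n)\in\mathbb R^n$ write $\mu_n(x)=\frac1n\sum_i x_i$. For $n=3$, let $\mathrm{ord}(x)=(x_{(1)},x_{(2)},x_{(3)})$ be the rearrangement of $x$ with $|x_{(1)}-\mu_3(x)|\le|x_{(2)}-\mu_3(x)|\le|x_{(3)}-\mu_3(x)|$, ties being broken uniformly at random; the *core* of the ordered triple is $(x_{(1)},x_{(2)})$. Let $Y=(Y_1,Y_2,Y_3)$ be (random or deterministic) points of $[0,1]$, almost surely distinct. The modified process is the Markov chain $\mathcal X(0)=\mathrm{ord}(Y)$ and, given $\mathcal X(0),\dots,\mathcal X(t)$ with $\mathcal X(t)=(X_{(1)}(t),X_{(2)}(t),X_{(3)}(t))$ and core $\mathcal X'(t)=(X_{(1)}(t),X_{(2)}(t))$, $$\mathcal X(t+1)=\mathrm{ord}\big(X_{(1)}(t),X_{(2)}(t),U_{t+1}\big),$$ where $U_{t+1}$ is uniform on $[\min\mathcal X'(t)-D(t),\ \max\mathcal X'(t)+D(t)]$ and $D(t)=|X_{(1)}(t)-X_{(2)}(t)|$. Write $\mu=\frac12\big(X_{(1)}(0)+X_{(2)}(0)\big)$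 and $D=D(0)$. **Proposition.** (i) There is a unique probability distribution on $\mathbb R$ (the law of $L$) that satisfies $$L\ \stackrel d=\ \begin{cases}-\frac{1+U}{2}+UL&\text{with probability }\frac13,\\[2pt]-\frac{2-U}{4}+\frac U2L&\text{with probability }\frac16,\\[2pt]\phantom{-}\frac{2-U}{4}+\frac U2L&\text{with probability }\frac16,\\[2pt]\phantom{-}\frac{1+U}{2}+UL&\text{with probability }\frac13,\end{cases}$$ where $U\sim U[0,1]$ and $L$ on the right are independent of each other and of the choice of the branch. It satisfies $L\stackrel d=-L$ and $\mathbb E|L|^k<\infty$ for all $k$, and $\theta_k:=\mathbb E[L^k]$ satisfies $\theta_k=0$ for odd $k$, $\theta_2=\frac7{12}$, $\theta_4=\frac{375}{368}$, $\theta_6=\frac{76693}{22080}$. (ii) For every modified process as above there is a real random variable $\xi_3$ such that $\mathcal X'(t)\to(\xi_3,\xi_3)$ almost surely as $t\to\infty$. It has the same distribution as $\mu+DL$, where $L$ has the law of (i) and is independent of $(\mu,D)$. All moments of $\xi_3$ are finite, and $$\mathbb E[\xi_3]=\mathbb E[\mu],\qquad \mathbb E[\xi_3^2]=\mathbb E[\mu^2]+\tfrac7{12}\mathbb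 E[D^2],\qquad \mathbb E[\xi_3^3]=\mathbb E[\mu^3]+\tfrac74\mathbb E[\mu D^2].$$ (iii) If $Y_1,Y_2,Y_3$ are independent $U[0,1]$, then $\mathbb E[\xi_3^k]=\frac12,\frac13,\frac14$ for $k=1,2,3$. (iv) If $Y=(\frac14,\frac12,\frac34)$, then $\mathbb E[\xi_3^k]=\frac12,\frac{29}{96},\frac{13}{64},\frac{873}{5888}$ for $k=1,2,3,4$. -/

import Mathlib

open MeasureTheory ProbabilityTheory Filter
open scoped Topology ENNReal

noncomputable section

namespace BeautyContest

/-- The barycentre of `n` points on the real line. -/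
def bary {n : ℕ} (x : Fin n → ℝ) : ℝ := (∑ i, x i) / n

/-- The diameter of a pair of points on the real line. -/
def diam (y : Fin 2 → ℝ) : ℝ := |y 0 - y 1|

/-- The core of an ordered triple: the last entry (the extreme point) is removed. -/
def core (x : Fin 3 → ℝ) : Fin 2 → ℝ := fun i => x i.castSucc

open Classical in
/-- The rearrangements of a triple that list it by nondecreasing distance to its barycentre. -/
def sortings (x : Fin 3 → ℝ) : Finset (Equiv.Perm (Fin 3)) :=
  Finset.univ.filter fun σ => Monotone fun i => |x (σ i) - bary x|

/-- The law of the vector of barycentric order statistics of a triple: a uniformly random choice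
among the admissible rearrangements (so that ties are broken at random). -/
def orderLaw (x : Fin 3 → ℝ) : Measure (Fin 3 → ℝ) :=
  ∑ σ ∈ sortings x, ((sortings x).card : ℝ≥0∞)⁻¹ • Measure.dirac (x ∘ σ)

/-- The uniform distribution on `[0, 1]`. -/
def uniform01 : Measure ℝ := volume.restrict (Set.Icc 0 1)

/-- The uniform distribution on `[a, b]`, `a ≤ b` (a point mass if `a = b`). -/
def uniformLaw (a b : ℝ) : Measure ℝ := uniform01.map fun v => a + (b - a) * v

/-- One step of the modified dynamics from the ordered triple `x`: the extreme point is replaced by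
a point `u`, uniform on the interval spanned by the core and widened by the diameter of the core
on each side, and the new triple is ordered. -/
def stepLaw (x : Fin 3 → ℝ) : Measure (Fin 3 → ℝ) :=
  (uniformLaw (min (core x 0) (core x 1) - diam (core x))
    (max (core x 0) (core x 1) + diam (core x))).bind
      fun u => orderLaw ![core x 0, core x 1, u]

theorem mem_sortings (x : Fin 3 → ℝ) (σ : Equiv.Perm (Fin 3)) :
    σ ∈ sortings x ↔ Monotone fun i => |x (σ i) - bary x| := by
  simp [sortings]

theorem sortings_nonempty (x : Fin 3 → ℝ) : (sortings x).Nonempty :=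
  ⟨Tuple.sort fun i => |x i - bary x|, (mem_sortings x _).2 (Tuple.monotone_sort fun i => |x i - bary x|)⟩

theorem measurable_bary {n : ℕ} : Measurable (bary : (Fin n → ℝ) → ℝ) := by
  unfold bary; fun_prop

theorem measurableSet_mem_sortings (σ : Equiv.Perm (Fin 3)) :
    MeasurableSet {x : Fin 3 → ℝ | σ ∈ sortings x} := by
  have h : {x : Fin 3 → ℝ | σ ∈ sortings x} =
      ⋂ (i : Fin 3) (j : Fin 3) (_ : i ≤ j),
        {x | |x (σ i) - bary x| ≤ |x (σ j) - bary x|} := by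
    ext x
    simp only [Set.mem_ofPred_eq, mem_sortings, Set.mem_iInter]
    exact ⟨fun h i j hij => h hij, fun h i j hij => h i j hij⟩
  rw [h]
  have hb := measurable_bary (n := 3)
  refine .iInter fun i => .iInter fun j => .iInter fun _ => measurableSet_le ?_ ?_ <;>
    exact ((measurable_pi_apply _).sub hb).abs

theorem measurable_orderLaw : Measurable orderLaw := by
  classical
  refine Measure.measurable_of_measurable_coe _ fun s hs => ?_
  have hcard : Measurable fun x : Fin 3 → ℝ => ((sortings x).card : ℝ≥0∞) := by
    have : (fun x : Fin 3 → ℝ => ((sortings x).card : ℝ≥0∞)) =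
        fun x => ∑ σ : Equiv.Perm (Fin 3), if σ ∈ sortings x then 1 else 0 := by
      ext x; simp
    rw [this]
    exact Finset.measurable_sum _ fun σ _ =>
      Measurable.ite (measurableSet_mem_sortings σ) measurable_const measurable_const
  have : (fun x : Fin 3 → ℝ => orderLaw x s) = fun x => ∑ σ : Equiv.Perm (Fin 3),
      if σ ∈ sortings x then ((sortings x).card : ℝ≥0∞)⁻¹ * Measure.dirac (x ∘ σ) s else 0 := by
    ext x
    simp [orderLaw, Measure.finsetSum_apply]
  rw [this]
  refine Finset.measurable_sum _ fun σ _ =>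
      Measurable.ite (measurableSet_mem_sortings σ) (hcard.inv.mul ?_) measurable_const
  have hσ : Measurable fun x : Fin 3 → ℝ => x ∘ σ :=
    measurable_pi_lambda _ fun i => measurable_pi_apply _
  exact (Measure.measurable_coe hs).comp (Measure.measurable_dirac.comp hσ)

instance isProbabilityMeasure_orderLaw (x : Fin 3 → ℝ) : IsProbabilityMeasure (orderLaw x) := by
  constructor
  have h : ((sortings x).card : ℝ≥0∞) ≠ 0 := by
    simpa using (sortings_nonempty x).ne_empty
  simp [orderLaw, Measure.finsetSum_apply, ENNReal.mul_inv_cancel h]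

instance isProbabilityMeasure_uniform01 : IsProbabilityMeasure uniform01 :=
  ⟨by simp [uniform01]⟩

instance isProbabilityMeasure_uniformLaw (a b : ℝ) : IsProbabilityMeasure (uniformLaw a b) :=
  Measure.isProbabilityMeasure_map (by fun_prop)

/-- The random ordering of a triple, as a Markov kernel. -/
def orderKernel : Kernel (Fin 3 → ℝ) (Fin 3 → ℝ) := ⟨orderLaw, measurable_orderLaw⟩

instance isMarkovKernel_orderKernel : IsMarkovKernel orderKernel :=
  ⟨isProbabilityMeasure_orderLaw⟩

theorem measurable_stepLaw : Measurable stepLaw := by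
  let g : (Fin 3 → ℝ) × ℝ → (Fin 3 → ℝ) := fun p =>
    ![core p.1 0, core p.1 1,
      (min (core p.1 0) (core p.1 1) - diam (core p.1)) +
        ((max (core p.1 0) (core p.1 1) + diam (core p.1)) -
          (min (core p.1 0) (core p.1 1) - diam (core p.1))) * p.2]
  have hg : Measurable g := by
    have h0 : Measurable fun p : (Fin 3 → ℝ) × ℝ => core p.1 0 :=
      (measurable_pi_apply _).comp measurable_fst
    have h1 : Measurable fun p : (Fin 3 → ℝ) × ℝ => core p.1 1 :=
      (measurable_pi_apply _).comp measurable_fst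
    have hd : Measurable fun p : (Fin 3 → ℝ) × ℝ => diam (core p.1) := (h0.sub h1).abs
    refine measurable_pi_lambda _ fun i => ?_
    fin_cases i
    · exact h0
    · exact h1
    · exact ((h0.min h1).sub hd).add
        ((((h0.max h1).add hd).sub ((h0.min h1).sub hd)).mul measurable_snd)
  have key : stepLaw = fun x =>
      (orderKernel ∘ₖ ((Kernel.id ×ₖ Kernel.const (Fin 3 → ℝ) uniform01).map g)) x := by
    funext x
    have hx : Measurable fun v : ℝ => g (x, v) := hg.comp measurable_prodMk_left
    have hu : Measurable fun u : ℝ => (![core x 0, core x 1, u] : Fin 3 → ℝ) := by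
      refine measurable_pi_lambda _ fun i => ?_
      fin_cases i
      · exact measurable_const
      · exact measurable_const
      · exact measurable_id
    rw [Kernel.comp_apply, Kernel.map_apply _ hg, Kernel.prod_apply, Kernel.id_apply,
      Kernel.const_apply, Measure.dirac_prod, Measure.map_map hg measurable_prodMk_left]
    refine Measure.ext fun s hs => ?_
    have ho : Measurable fun u : ℝ => orderLaw ![core x 0, core x 1, u] :=
      measurable_orderLaw.comp hu
    have hos : Measurable fun u : ℝ => orderLaw ![core x 0, core x 1, u] s :=
      (Measure.measurable_coe hs).comp ho
    have hks : Measurable fun y : Fin 3 → ℝ => orderKernel y s :=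
      (Measure.measurable_coe hs).comp orderKernel.measurable
    rw [stepLaw, Measure.bind_apply hs ho.aemeasurable,
      Measure.bind_apply hs orderKernel.measurable.aemeasurable, uniformLaw,
      lintegral_map hos (by fun_prop), lintegral_map hks (hg.comp measurable_prodMk_left)]
    rfl
  rw [key]
  exact Kernel.measurable _

/-- One step of the modified dynamics, as a kernel. -/
def stepKernel : Kernel (Fin 3 → ℝ) (Fin 3 → ℝ) := ⟨stepLaw, measurable_stepLaw⟩

instance isMarkovKernel_stepKernel : IsMarkovKernel stepKernel := by
  refine ⟨fun x => ?_⟩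
  have hu : Measurable fun u : ℝ => (![core x 0, core x 1, u] : Fin 3 → ℝ) := by
    refine measurable_pi_lambda _ fun i => ?_
    fin_cases i
    · exact measurable_const
    · exact measurable_const
    · exact measurable_id
  exact isProbabilityMeasure_bind (measurable_orderLaw.comp hu).aemeasurable
    (.of_forall fun _ => inferInstance)

/-- `X` is (a version of) the modified process of ordered triples, started from three points with
joint law `α`: the initial state is the random ordering of these points, and the conditional law of
the state at time `t + 1` given the states up to time `t` is the step law from the state
at time `t`. -/
structure IsModifiedProcess {Ω : Type*} [MeasurableSpace Ω] (P : Measure Ω)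
    (α : Measure (Fin 3 → ℝ)) (X : ℕ → Ω → Fin 3 → ℝ) : Prop where
  initial : HasLaw (X 0) (orderKernel ∘ₘ α) P
  step : ∀ t : ℕ, HasCondDistrib (X (t + 1))
    (fun ω => fun s : Finset.Iic t => X s ω)
    (stepKernel.comap (fun h : Finset.Iic t → Fin 3 → ℝ => h ⟨t, Finset.mem_Iic.2 le_rfl⟩)
      (measurable_pi_apply _)) P

/-- The law of the right-hand side of the fixed-point equation, for independent `U` uniform on
`[0, 1]` and `L` of law `ν`: the mixture of the laws of
`-(1 + U)/2 + U L`, `-(2 - U)/4 + (U/2) L`, `(2 - U)/4 + (U/2) L`, `(1 + U)/2 + U L`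
with weights `1/3, 1/6, 1/6, 1/3`. -/
def fixMap (ν : Measure ℝ) : Measure ℝ :=
  (1 / 3 : ℝ≥0∞) • (uniform01.prod ν).map (fun p => -((1 + p.1) / 2) + p.1 * p.2) +
  (1 / 6 : ℝ≥0∞) • (uniform01.prod ν).map (fun p => -((2 - p.1) / 4) + p.1 / 2 * p.2) +
  (1 / 6 : ℝ≥0∞) • (uniform01.prod ν).map (fun p => (2 - p.1) / 4 + p.1 / 2 * p.2) +
  (1 / 3 : ℝ≥0∞) • (uniform01.prod ν).map (fun p => (1 + p.1) / 2 + p.1 * p.2)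

end BeautyContest

end

noncomputable section

namespace BeautyContest

/-! ### The uniform distribution, split along the branches of one step -/

/-! Only the centre `m` and the diameter `d` of the core matter. If the new point has relative
position `v` in its interval, of length `3 * d`, then the core point on the opposite side of the
centre is the extreme one, whatever the scale. Hence `(m, d)` becomes `(m + d * A, d * B)` with `A =
centreCoef v`, `B = diamCoef v`, and `v` uniform (`lintegral_coreStat_stepLaw`). Splitting `[0, 1]`
at `1/3, 1/2, 2/3` shows that `(A, B)` has exactly the four branches of the fixed-point equation
(`lintegral_coef`), so that equation reads `L = A + B * L` in law (`fixMap_eq_map`).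

Existence: iterating gives the series `limitPoint`, summable because `E[B] = 5/12 < 1` and `|A| ≤
1`; shifting the driving sequence shows that its law solves the equation (`limitLaw_eq_fixMap`).
Convexity of the exponential yields a uniform exponential moment, hence all moments.

Uniqueness (`eq_of_eq_fixMap`): the difference of two characteristic functions at `t` is bounded by
the mean of its modulus at `t * B`. With probability `1/3` one has `B ≤ 1/2`, so a bound on `|t| ≤ T
/ 2` propagates to `|t| ≤ T`; near `0` continuity makes the bound arbitrarily small. No moment
assumption is needed. Symmetry follows from uniqueness, and each even moment then solves a linear
equation.

Convergence: the mean diameters decay geometrically and the centre moves by at most one diameter per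
step, so the core converges. For `L` independent of the process, the law of `m + d * L` does not
change along the dynamics, by the fixed-point equation; at time `0` it is the claimed law and as
time grows it tends to the law of the limit (`IsModifiedProcess.map_limit`). The moments follow by
binomial expansion, and the two examples only need the law of the initial core. -/

theorem setLIntegral_uIcc_affine (p c : ℝ) (hc : c ≠ 0) (f : ℝ → ℝ≥0∞) :
    ∫⁻ x in Set.uIcc p (p + c), f x = ENNReal.ofReal |c| * ∫⁻ u, f (p + c * u) ∂uniform01 := by
  have h01 : (0 : ℝ) ≤ 1 := zero_le_one
  have himg : (fun u : ℝ => p + c * u) '' Set.Icc 0 1 = Set.uIcc p (p + c) := by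
    have h1 : (fun u : ℝ => p + c * u) = (fun u => p + u) ∘ fun u => c * u := rfl
    rw [h1, Set.image_comp, ← Set.uIcc_of_le h01, Set.image_const_mul_uIcc,
      Set.image_const_add_uIcc]
    simp
  have hinj : Set.InjOn (fun u : ℝ => p + c * u) (Set.Icc 0 1) := fun u _ v _ h => by
    simpa [hc] using h
  have hder : ∀ u ∈ Set.Icc (0 : ℝ) 1,
      HasDerivWithinAt (fun u : ℝ => p + c * u) c (Set.Icc 0 1) u := fun u _ => by
    simpa using (((hasDerivAt_id u).const_mul c).const_add p).hasDerivWithinAt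
  rw [← himg, lintegral_image_eq_lintegral_abs_deriv_mul measurableSet_Icc hder hinj,
    lintegral_const_mul' _ _ ENNReal.ofReal_ne_top, uniform01]

theorem setLIntegral_Icc_add_adjacent {p q r : ℝ} (hpq : p ≤ q) (hqr : q ≤ r) (f : ℝ → ℝ≥0∞) :
    ∫⁻ x in Set.Icc p r, f x = (∫⁻ x in Set.Icc p q, f x) + ∫⁻ x in Set.Icc q r, f x := by
  simp only [← restrict_Ioc_eq_restrict_Icc]
  rw [← Set.Ioc_union_Ioc_eq_Ioc hpq hqr, lintegral_union measurableSet_Ioc]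
  exact Set.Ioc_disjoint_Ioc_of_le (le_refl q)

/-- The breakpoints `1/3` and `2/3` are the positions of the two core points and `1/2` that of the
centre. Each piece is parametrised outwards from the nearer core point, so that `u` measures the
distance to it. -/
theorem lintegral_uniform01_eq_sum (f : ℝ → ℝ≥0∞) :
    ∫⁻ v, f v ∂uniform01 =
      1 / 3 * ∫⁻ u, f (1 / 3 + -1 / 3 * u) ∂uniform01 +
      1 / 6 * ∫⁻ u, f (1 / 3 + 1 / 6 * u) ∂uniform01 +
      1 / 6 * ∫⁻ u, f (2 / 3 + -1 / 6 * u) ∂uniform01 +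
      1 / 3 * ∫⁻ u, f (2 / 3 + 1 / 3 * u) ∂uniform01 := by
  have h3 : ENNReal.ofReal (1 / 3) = 1 / 3 := by
    rw [ENNReal.ofReal_div_of_pos (by norm_num)]; simp
  have h6 : ENNReal.ofReal (1 / 6) = 1 / 6 := by
    rw [ENNReal.ofReal_div_of_pos (by norm_num)]; simp
  have e1 := setLIntegral_uIcc_affine (1 / 3) (-1 / 3) (by norm_num) f
  have e2 := setLIntegral_uIcc_affine (1 / 3) (1 / 6) (by norm_num) f
  have e3 := setLIntegral_uIcc_affine (2 / 3) (-1 / 6) (by norm_num) f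
  have e4 := setLIntegral_uIcc_affine (2 / 3) (1 / 3) (by norm_num) f
  rw [show |(-1 / 3 : ℝ)| = 1 / 3 by norm_num [abs_div], h3] at e1
  rw [show |(1 / 6 : ℝ)| = 1 / 6 by norm_num [abs_div], h6] at e2
  rw [show |(-1 / 6 : ℝ)| = 1 / 6 by norm_num [abs_div], h6] at e3
  rw [show |(1 / 3 : ℝ)| = 1 / 3 by norm_num [abs_div], h3] at e4
  rw [← e1, ← e2, ← e3, ← e4, Set.uIcc_of_ge (by norm_num), Set.uIcc_of_le (by norm_num),
    Set.uIcc_of_ge (by norm_num), Set.uIcc_of_le (by norm_num), uniform01,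
    show (1 / 3 + -1 / 3 : ℝ) = 0 by norm_num, show (1 / 3 + 1 / 6 : ℝ) = 1 / 2 by norm_num,
    show (2 / 3 + -1 / 6 : ℝ) = 1 / 2 by norm_num, show (2 / 3 + 1 / 3 : ℝ) = 1 by norm_num,
    ← setLIntegral_Icc_add_adjacent (p := 0) (q := 1 / 3) (r := 1 / 2) (by norm_num) (by norm_num),
    ← setLIntegral_Icc_add_adjacent (p := 0) (q := 1 / 2) (r := 2 / 3) (by norm_num) (by norm_num),
    ← setLIntegral_Icc_add_adjacent (p := 0) (q := 2 / 3) (r := 1) (by norm_num) (by norm_num)]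

/-- The displacement of the centre of a core of centre `0` and diameter `1` in one step, in terms
of the relative position of the new point. -/
def centreCoef (v : ℝ) : ℝ := if v < 1 / 2 then -(2 - 3 * v) / 2 else (3 * v - 1) / 2

/-- The diameter after one step from a core of diameter `1`, in terms of the relative position of
the new point. -/
def diamCoef (v : ℝ) : ℝ := if v < 1 / 2 then |1 - 3 * v| else |3 * v - 2|

theorem measurable_centreCoef : Measurable centreCoef :=
  Measurable.ite measurableSet_Iio (by fun_prop) (by fun_prop)

theorem measurable_diamCoef : Measurable diamCoef :=
  Measurable.ite measurableSet_Iio (by fun_prop) (by fun_prop)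

theorem diamCoef_nonneg (v : ℝ) : 0 ≤ diamCoef v := by
  unfold diamCoef; split_ifs <;> positivity

theorem diamCoef_le_one {v : ℝ} (hv : v ∈ Set.Icc (0 : ℝ) 1) : diamCoef v ≤ 1 := by
  obtain ⟨h0, h1⟩ := hv
  unfold diamCoef; split_ifs <;> rw [abs_le] <;> constructor <;> linarith

theorem abs_centreCoef_le_one {v : ℝ} (hv : v ∈ Set.Icc (0 : ℝ) 1) : |centreCoef v| ≤ 1 := by
  obtain ⟨h0, h1⟩ := hv
  unfold centreCoef; split_ifs <;> rw [abs_le] <;> constructor <;> linarith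

theorem ae_uniform01_mem : ∀ᵐ v ∂uniform01, v ∈ Set.Icc (0 : ℝ) 1 :=
  ae_restrict_mem measurableSet_Icc

instance nullSingletonClass_uniform01 : NullSingletonClass uniform01 := by
  unfold uniform01; infer_instance

theorem ae_uniform01_ne (c : ℝ) : ∀ᵐ v ∂uniform01, v ≠ c :=
  Measure.ae_ne _ c

theorem lintegral_coef (g : ℝ → ℝ → ℝ≥0∞) :
    ∫⁻ v, g (centreCoef v) (diamCoef v) ∂uniform01 =
      1 / 3 * ∫⁻ u, g (-((1 + u) / 2)) u ∂uniform01 +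
      1 / 6 * ∫⁻ u, g (-((2 - u) / 4)) (u / 2) ∂uniform01 +
      1 / 6 * ∫⁻ u, g ((2 - u) / 4) (u / 2) ∂uniform01 +
      1 / 3 * ∫⁻ u, g ((1 + u) / 2) u ∂uniform01 := by
  have key : ∀ {f f' : ℝ → ℝ≥0∞}, (∀ u, 0 ≤ u → u < 1 → f u = f' u) →
      ∫⁻ u, f u ∂uniform01 = ∫⁻ u, f' u ∂uniform01 := fun h => by
    refine lintegral_congr_ae ?_
    -- On the branch `1/3 + u/6` the value `u = 1` gives `v = 1/2`, which `centreCoef` and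
    -- `diamCoef` assign to the other side; it is discarded as a null set.
    filter_upwards [ae_uniform01_mem, ae_uniform01_ne 1] with u hu hu1
    exact h u hu.1 (lt_of_le_of_ne hu.2 hu1)
  rw [lintegral_uniform01_eq_sum]
  congr 1
  · congr 1
    · congr 1
      all_goals
        congr 1
        refine key fun u h0 h1 => ?_
      · rw [centreCoef, diamCoef, if_pos (by linarith), if_pos (by linarith),
          abs_of_nonneg (by linarith)]
        congr 1 <;> ring
      · rw [centreCoef, diamCoef, if_pos (by linarith), if_pos (by linarith),
          abs_of_nonpos (by linarith)]
        congr 1 <;> ring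
    · congr 1
      refine key fun u h0 h1 => ?_
      rw [centreCoef, diamCoef, if_neg (by linarith), if_neg (by linarith),
        abs_of_nonpos (by linarith)]
      congr 1 <;> ring
  · congr 1
    refine key fun u h0 h1 => ?_
    rw [centreCoef, diamCoef, if_neg (by linarith), if_neg (by linarith),
      abs_of_nonneg (by linarith)]
    congr 1 <;> ring

theorem lintegral_fixMap (ν : Measure ℝ) [SFinite ν] {f : ℝ → ℝ≥0∞} (hf : Measurable f) :
    ∫⁻ x, f x ∂fixMap ν =
      ∫⁻ v, ∫⁻ l, f (centreCoef v + diamCoef v * l) ∂ν ∂uniform01 := by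
  rw [lintegral_coef fun a b => ∫⁻ l, f (a + b * l) ∂ν, fixMap]
  simp only [lintegral_add_measure, lintegral_smul_measure, smul_eq_mul]
  rw [lintegral_map hf (by fun_prop), lintegral_map hf (by fun_prop), lintegral_map hf (by fun_prop),
    lintegral_map hf (by fun_prop), lintegral_prod _ (by fun_prop), lintegral_prod _ (by fun_prop),
    lintegral_prod _ (by fun_prop), lintegral_prod _ (by fun_prop)]

/-- The mixture over four branches is driven by one uniform variable; this form makes the
fixed-point equation match one step of the dynamics. -/
theorem fixMap_eq_map (ν : Measure ℝ) [SFinite ν] :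
    fixMap ν = (uniform01.prod ν).map fun p => centreCoef p.1 + diamCoef p.1 * p.2 := by
  have hm : Measurable fun p : ℝ × ℝ => centreCoef p.1 + diamCoef p.1 * p.2 :=
    (measurable_centreCoef.comp measurable_fst).add
      ((measurable_diamCoef.comp measurable_fst).mul measurable_snd)
  refine Measure.ext_of_lintegral _ fun f hf => ?_
  rw [lintegral_fixMap ν hf, lintegral_map hf hm]
  exact (lintegral_prod _ (hf.comp hm).aemeasurable).symm

theorem integral_uniform01 (f : ℝ → ℝ) : ∫ u, f u ∂uniform01 = ∫ u in (0 : ℝ)..1, f u := by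
  rw [intervalIntegral.integral_of_le zero_le_one, uniform01, restrict_Ioc_eq_restrict_Icc]

theorem lintegral_diamCoef :
    ∫⁻ v, ENNReal.ofReal (diamCoef v) ∂uniform01 = ENNReal.ofReal (5 / 12) := by
  have hid : ∀ c : ℝ, 0 ≤ c → ∫⁻ u, ENNReal.ofReal (u / c) ∂uniform01 = ENNReal.ofReal (1 / 2 / c) := by
    intro c hc
    rw [← ofReal_integral_eq_lintegral_ofReal, integral_uniform01]
    · simp
    · have hcont : Continuous fun u : ℝ => u / c := by fun_prop
      exact hcont.integrableOn_Icc
    · filter_upwards [ae_uniform01_mem] with u hu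
      exact div_nonneg hu.1 hc
  have h1 := hid 1 zero_le_one
  simp only [div_one] at h1
  have h3 : (1 / 3 : ℝ≥0∞) = ENNReal.ofReal (1 / 3) := by
    rw [ENNReal.ofReal_div_of_pos (by norm_num)]; simp
  have h6 : (1 / 6 : ℝ≥0∞) = ENNReal.ofReal (1 / 6) := by
    rw [ENNReal.ofReal_div_of_pos (by norm_num)]; simp
  rw [lintegral_coef fun _ b => ENNReal.ofReal b, h1, hid 2 zero_le_two, h3, h6,
    ← ENNReal.ofReal_mul (by norm_num), ← ENNReal.ofReal_mul (by norm_num),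
    ← ENNReal.ofReal_add (by norm_num) (by norm_num), ← ENNReal.ofReal_add (by norm_num) (by norm_num),
    ← ENNReal.ofReal_add (by norm_num) (by norm_num)]
  norm_num

/-! ### The centre and the diameter of the core after one step -/

/-- The centre and the diameter of the core of an ordered triple. -/
def coreStat (x : Fin 3 → ℝ) : ℝ × ℝ := (bary (core x), diam (core x))

/-- The centre and the diameter of the next core, if `v` is the relative position of the new
point. -/
def nextStat (s : ℝ × ℝ) (v : ℝ) : ℝ × ℝ := (s.1 + s.2 * centreCoef v, s.2 * diamCoef v)

theorem measurable_coreStat : Measurable coreStat := by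
  unfold coreStat bary diam core; fun_prop

theorem measurable_nextStat : Measurable fun p : (ℝ × ℝ) × ℝ => nextStat p.1 p.2 := by
  have := measurable_centreCoef
  have := measurable_diamCoef
  unfold nextStat; fun_prop

/-- The random tie-breaking is invisible to a function that takes the same value on all admissible
rearrangements. -/
theorem lintegral_orderLaw {x : Fin 3 → ℝ} {g : (Fin 3 → ℝ) → ℝ≥0∞} {c : ℝ≥0∞}
    (h : ∀ σ ∈ sortings x, g (x ∘ σ) = c) : ∫⁻ y, g y ∂orderLaw x = c := by
  have h0 : ((sortings x).card : ℝ≥0∞) ≠ 0 := by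
    simpa using (sortings_nonempty x).ne_empty
  rw [orderLaw, lintegral_finsetSum_measure]
  simp only [lintegral_smul_measure, lintegral_dirac, smul_eq_mul]
  rw [Finset.sum_congr rfl fun σ hσ => by rw [h σ hσ], Finset.sum_const, nsmul_eq_mul, ← mul_assoc,
    ENNReal.mul_inv_cancel h0 (by simp), one_mul]

theorem apply_two_of_mem_sortings {x : Fin 3 → ℝ} {σ : Equiv.Perm (Fin 3)} (hσ : σ ∈ sortings x)
    {i : Fin 3} (hi : ∀ j, j ≠ i → |x j - bary x| < |x i - bary x|) : σ 2 = i := by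
  by_contra hne
  have h := (mem_sortings x σ).1 hσ (Fin.le_last (σ.symm i))
  simp only [Equiv.apply_symm_apply] at h
  exact absurd (hi _ hne) (not_lt.2 h)

/-- The order within the core is irrelevant to a symmetric function, so only the index of the
removed point counts. -/
theorem symm_apply_comp_perm {α : Type*} (f : ℝ → ℝ → α) (hf : ∀ a b, f a b = f b a)
    (x : Fin 3 → ℝ) (σ : Equiv.Perm (Fin 3)) :
    f (x (σ 0)) (x (σ 1)) = f (x ((σ 2).succAbove 0)) (x ((σ 2).succAbove 1)) := by
  have h01 : σ 0 ≠ σ 1 := by simp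
  have h02 : σ 0 ≠ σ 2 := by simp
  have h12 : σ 1 ≠ σ 2 := by simp
  generalize σ 0 = i at *
  generalize σ 1 = j at *
  generalize σ 2 = k at *
  fin_cases k <;> fin_cases i <;> simp at h02 <;> fin_cases j <;> simp at h01 h12 <;>
    first | rfl | exact hf _ _

/-- The centre and the diameter of what remains of a triple if the point `i` is removed. -/
def restStat (x : Fin 3 → ℝ) (i : Fin 3) : ℝ × ℝ :=
  ((x (i.succAbove 0) + x (i.succAbove 1)) / 2, |x (i.succAbove 0) - x (i.succAbove 1)|)

theorem coreStat_comp_perm (x : Fin 3 → ℝ) (σ : Equiv.Perm (Fin 3)) :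
    coreStat (x ∘ σ) = restStat x (σ 2) := by
  rw [restStat, ← symm_apply_comp_perm (fun a b => ((a + b) / 2, |a - b|))
    (fun a b => by rw [add_comm, abs_sub_comm]) x σ]
  simp [coreStat, bary, diam, core]

theorem lintegral_coreStat_orderLaw {x : Fin 3 → ℝ} {i : Fin 3} (g : ℝ × ℝ → ℝ≥0∞)
    (hi : ∀ j, j ≠ i → |x j - bary x| < |x i - bary x|) :
    ∫⁻ y, g (coreStat y) ∂orderLaw x = g (restStat x i) :=
  lintegral_orderLaw fun σ hσ => by rw [coreStat_comp_perm, apply_two_of_mem_sortings hσ hi]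

theorem lintegral_coreStat_orderLaw_of_eq (c : ℝ) (g : ℝ × ℝ → ℝ≥0∞) :
    ∫⁻ y, g (coreStat y) ∂orderLaw (fun _ => c) = g (c, 0) :=
  lintegral_orderLaw fun σ _ => by rw [coreStat_comp_perm]; simp [restStat]

/-- The triple obtained from the ordered triple `x` if the relative position of the new point
is `v`. -/
def addPoint (x : Fin 3 → ℝ) (v : ℝ) : Fin 3 → ℝ :=
  ![x 0, x 1, (x 0 + x 1) / 2 - 3 / 2 * |x 0 - x 1| + 3 * |x 0 - x 1| * v]

theorem abs_eq_mul_abs {p c q : ℝ} (hc : 0 ≤ c) (h : p = c * q ∨ p = -(c * q)) :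
    |p| = c * |q| := by
  rcases h with rfl | rfl
  · rw [abs_mul, abs_of_nonneg hc]
  · rw [abs_neg, abs_mul, abs_of_nonneg hc]

/-- For `v < 1/2` the new point is closer to the left core point than the right one is, so the right
one is strictly extreme; for `v > 1/2` the roles are exchanged. The values `0`, `1/2`, `1` are those
where ties occur. -/
theorem lintegral_coreStat_addPoint (x : Fin 3 → ℝ) {v : ℝ} (h0 : 0 < v) (h1 : v < 1)
    (h2 : v ≠ 1 / 2) (g : ℝ × ℝ → ℝ≥0∞) :
    ∫⁻ y, g (coreStat y) ∂orderLaw (addPoint x v) = g (nextStat (coreStat x) v) := by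
  obtain ⟨a, ha⟩ : ∃ a, x 0 = a := ⟨_, rfl⟩
  obtain ⟨b, hb⟩ : ∃ b, x 1 = b := ⟨_, rfl⟩
  have hx : coreStat x = ((a + b) / 2, |a - b|) := by
    simp [coreStat, bary, diam, core, ha, hb]
  rw [hx, addPoint, ha, hb]
  have hbary : ∀ u, bary ![a, b, u] = (a + b + u) / 3 := fun u => by
    simp [bary, Fin.sum_univ_three]
  have key : ∀ (i : Fin 3) (u : ℝ),
      (∀ j, j ≠ i → |![a, b, u] j - (a + b + u) / 3| < |![a, b, u] i - (a + b + u) / 3|) →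
      restStat ![a, b, u] i = nextStat ((a + b) / 2, |a - b|) v →
      ∫⁻ y, g (coreStat y) ∂orderLaw ![a, b, u] = g (nextStat ((a + b) / 2, |a - b|) v) := by
    intro i u hi hr
    rw [← hr]
    exact lintegral_coreStat_orderLaw g (by rwa [hbary])
  rcases lt_trichotomy a b with hab | hab | hab
  · rw [abs_of_neg (by linarith)] at key ⊢
    have k0 : 0 < (b - a) * v := mul_pos (by linarith) h0
    have k1 : 0 < (b - a) * (1 - v) := mul_pos (by linarith) (by linarith)
    rcases lt_or_gt_of_ne h2 with hv | hv
    · have k2 : 0 < (b - a) * (1 / 2 - v) := mul_pos (by linarith) (by linarith)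
      refine key 1 _ (fun j hj => ?_) ?_
      · rw [lt_abs]; left
        fin_cases j <;> simp at hj <;> simp <;> rw [abs_lt] <;> constructor <;> linarith
      · rw [nextStat, centreCoef, diamCoef, if_pos hv, if_pos hv, restStat, Prod.mk.injEq]
        constructor
        · simp; ring
        · refine abs_eq_mul_abs (by linarith) ?_
          simp
          left; ring
    · have k2 : 0 < (b - a) * (v - 1 / 2) := mul_pos (by linarith) (by linarith)
      refine key 0 _ (fun j hj => ?_) ?_
      · rw [lt_abs]; right
        fin_cases j <;> simp at hj <;> simp <;> rw [abs_lt] <;> constructor <;> linarith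
      · rw [nextStat, centreCoef, diamCoef, if_neg hv.not_gt, if_neg hv.not_gt, restStat,
          Prod.mk.injEq]
        constructor
        · simp; ring
        · refine abs_eq_mul_abs (by linarith) ?_
          simp
          right; ring
  · subst hab
    -- A degenerate core never moves: all three points coincide, every ordering is admissible, and
    -- the recursion with diameter `0` says the same.
    have : (![a, a, (a + a) / 2 - 3 / 2 * |a - a| + 3 * |a - a| * v] : Fin 3 → ℝ) = fun _ => a := by
      ext i; fin_cases i <;> simp
    rw [this, lintegral_coreStat_orderLaw_of_eq]
    simp [nextStat]
  · rw [abs_of_pos (by linarith)] at key ⊢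
    have k0 : 0 < (a - b) * v := mul_pos (by linarith) h0
    have k1 : 0 < (a - b) * (1 - v) := mul_pos (by linarith) (by linarith)
    rcases lt_or_gt_of_ne h2 with hv | hv
    · have k2 : 0 < (a - b) * (1 / 2 - v) := mul_pos (by linarith) (by linarith)
      refine key 0 _ (fun j hj => ?_) ?_
      · rw [lt_abs]; left
        fin_cases j <;> simp at hj <;> simp <;> rw [abs_lt] <;> constructor <;> linarith
      · rw [nextStat, centreCoef, diamCoef, if_pos hv, if_pos hv, restStat, Prod.mk.injEq]
        constructor
        · simp; ring
        · refine abs_eq_mul_abs (by linarith) ?_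
          simp
          left; ring
    · have k2 : 0 < (a - b) * (v - 1 / 2) := mul_pos (by linarith) (by linarith)
      refine key 1 _ (fun j hj => ?_) ?_
      · rw [lt_abs]; right
        fin_cases j <;> simp at hj <;> simp <;> rw [abs_lt] <;> constructor <;> linarith
      · rw [nextStat, centreCoef, diamCoef, if_neg hv.not_gt, if_neg hv.not_gt, restStat,
          Prod.mk.injEq]
        constructor
        · simp; ring
        · refine abs_eq_mul_abs (by linarith) ?_
          simp
          right; ring

theorem lintegral_coreStat_stepLaw (x : Fin 3 → ℝ) {g : ℝ × ℝ → ℝ≥0∞} (hg : Measurable g) :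
    ∫⁻ y, g (coreStat y) ∂stepLaw x = ∫⁻ v, g (nextStat (coreStat x) v) ∂uniform01 := by
  have hu : Measurable fun u : ℝ => (![core x 0, core x 1, u] : Fin 3 → ℝ) := by
    refine measurable_pi_lambda _ fun i => ?_
    fin_cases i
    · exact measurable_const
    · exact measurable_const
    · exact measurable_id
  have ho : Measurable fun u : ℝ => orderLaw ![core x 0, core x 1, u] :=
    measurable_orderLaw.comp hu
  have hgs : Measurable fun y => g (coreStat y) := hg.comp measurable_coreStat
  rw [stepLaw, Measure.lintegral_bind ho.aemeasurable hgs.aemeasurable, uniformLaw]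
  refine (lintegral_map ((Measure.measurable_lintegral hgs).comp ho) (by fun_prop)).trans ?_
  refine lintegral_congr_ae ?_
  filter_upwards [ae_uniform01_mem, ae_uniform01_ne 0, ae_uniform01_ne 1, ae_uniform01_ne (1 / 2)]
    with v hv hv0 hv1 hv2
  rw [← lintegral_coreStat_addPoint x (lt_of_le_of_ne hv.1 (Ne.symm hv0)) (lt_of_le_of_ne hv.2 hv1)
    hv2 g, addPoint]
  have e0 : core x 0 = x 0 := rfl
  have e1 : core x 1 = x 1 := rfl
  have e2 : diam (core x) = |x 0 - x 1| := rfl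
  have e3 : min (x 0) (x 1) - |x 0 - x 1| + (max (x 0) (x 1) + |x 0 - x 1| -
      (min (x 0) (x 1) - |x 0 - x 1|)) * v =
      (x 0 + x 1) / 2 - 3 / 2 * |x 0 - x 1| + 3 * |x 0 - x 1| * v := by
    rcases le_total (x 0) (x 1) with h | h
    · rw [min_eq_left h, max_eq_right h, abs_of_nonpos (by linarith)]; ring
    · rw [min_eq_right h, max_eq_left h, abs_of_nonneg (by linarith)]; ring
  rw [e0, e1, e2, e3]
  rfl

/-! ### Existence of a solution of the fixed-point equation -/

/-- The law of a sequence of independent uniform random variables. -/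
def iidLaw : Measure (ℕ → ℝ) := Measure.infinitePi fun _ => uniform01

instance isProbabilityMeasure_iidLaw : IsProbabilityMeasure iidLaw := by
  unfold iidLaw; infer_instance

/-- The sequence with a given first term and a given shifted sequence. -/
def consSeq (p : ℝ × (ℕ → ℝ)) : ℕ → ℝ
  | 0 => p.1
  | n + 1 => p.2 n

theorem measurable_consSeq : Measurable consSeq := by
  refine measurable_pi_lambda _ fun n => ?_
  cases n with
  | zero => exact measurable_fst
  | succ n => exact (measurable_pi_apply n).comp measurable_snd

/-- Prepending an independent uniform variable to an i.i.d. sequence leaves its law unchanged; it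
suffices to check cylinder sets. -/
theorem map_consSeq : (uniform01.prod iidLaw).map consSeq = iidLaw := by
  classical
  refine Measure.eq_infinitePi _ fun s t ht => ?_
  -- Padding with the whole line makes the index set an initial segment, from which the coordinate
  -- `0` splits off.
  let t' : ℕ → Set ℝ := fun i => if i ∈ s then t i else Set.univ
  have ht' : ∀ i, MeasurableSet (t' i) := fun i => by
    simp only [t']; split_ifs
    · exact ht i
    · exact .univ
  obtain ⟨N, hN⟩ : ∃ N, s ⊆ Finset.range (N + 1) :=
    ⟨s.sup id, fun i hi => Finset.mem_range.2 (Nat.lt_succ_of_le (Finset.le_sup (f := id) hi))⟩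
  have hset : Set.pi (s : Set ℕ) t = Set.pi (Finset.range (N + 1) : Set ℕ) t' := by
    ext w
    simp only [Set.mem_pi, Finset.mem_coe, t']
    refine ⟨fun h i _ => ?_, fun h i hi => ?_⟩
    · split_ifs with hi
      · exact h i hi
      · trivial
    · simpa [hi] using h i (hN hi)
  have hprod : ∏ i ∈ s, uniform01 (t i) = ∏ i ∈ Finset.range (N + 1), uniform01 (t' i) := by
    rw [← Finset.prod_subset hN (fun i _ hi => by simp [t', hi])]
    exact Finset.prod_congr rfl fun i hi => by simp [t', hi]
  have hpre : consSeq ⁻¹' Set.pi (Finset.range (N + 1) : Set ℕ) t' =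
      t' 0 ×ˢ Set.pi (Finset.range N : Set ℕ) fun i => t' (i + 1) := by
    ext ⟨v, w⟩
    simp only [Set.mem_preimage, Set.mem_pi, Finset.mem_coe, Finset.mem_range, Set.mem_prod]
    refine ⟨fun h => ⟨h 0 (Nat.succ_pos _), fun i hi => h (i + 1) (by omega)⟩, fun h i hi => ?_⟩
    cases i with
    | zero => exact h.1
    | succ i => exact h.2 i (by omega)
  rw [hset, hprod, Measure.map_apply measurable_consSeq
    (.pi (Finset.countable_toSet _) fun i _ => ht' i), hpre, Measure.prod_prod, iidLaw,
    Measure.infinitePi_pi _ fun i _ => ht' (i + 1), Finset.prod_range_succ', mul_comm]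

theorem lintegral_iidLaw {F : (ℕ → ℝ) → ℝ≥0∞} (hF : Measurable F) :
    ∫⁻ w, F w ∂iidLaw = ∫⁻ v, ∫⁻ w, F (consSeq (v, w)) ∂iidLaw ∂uniform01 := by
  conv_lhs => rw [← map_consSeq]
  rw [lintegral_map hF measurable_consSeq]
  exact lintegral_prod _ (hF.comp measurable_consSeq).aemeasurable

theorem ae_iidLaw_mem : ∀ᵐ w ∂iidLaw, ∀ n, w n ∈ Set.Icc (0 : ℝ) 1 := by
  rw [ae_all_iff]
  intro n
  have h := measurePreserving_eval_infinitePi (fun _ : ℕ => uniform01) n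
  exact h.quasiMeasurePreserving.ae ae_uniform01_mem

/-- The diameter of the core after `n` steps, from a core of diameter `1`. -/
def prodDiam (n : ℕ) (w : ℕ → ℝ) : ℝ := ∏ i ∈ Finset.range n, diamCoef (w i)

/-- The limit of the centre of the core, from a core of centre `0` and diameter `1`. -/
def limitPoint (w : ℕ → ℝ) : ℝ := ∑' n, prodDiam n w * centreCoef (w n)

theorem measurable_prodDiam (n : ℕ) : Measurable (prodDiam n) :=
  Finset.measurable_prod _ fun i _ => measurable_diamCoef.comp (measurable_pi_apply i)

theorem prodDiam_nonneg (n : ℕ) (w : ℕ → ℝ) : 0 ≤ prodDiam n w :=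
  Finset.prod_nonneg fun _ _ => diamCoef_nonneg _

theorem prodDiam_consSeq (n : ℕ) (v : ℝ) (w : ℕ → ℝ) :
    prodDiam (n + 1) (consSeq (v, w)) = diamCoef v * prodDiam n w := by
  rw [prodDiam, Finset.prod_range_succ', mul_comm]; rfl

theorem lintegral_prodDiam (n : ℕ) :
    ∫⁻ w, ENNReal.ofReal (prodDiam n w) ∂iidLaw = ENNReal.ofReal (5 / 12) ^ n := by
  induction n with
  | zero => simp [prodDiam]
  | succ n ih =>
    rw [lintegral_iidLaw (measurable_prodDiam _).ennreal_ofReal]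
    simp only [prodDiam_consSeq, ENNReal.ofReal_mul (diamCoef_nonneg _)]
    simp only [lintegral_const_mul _ (measurable_prodDiam n).ennreal_ofReal, ih]
    rw [lintegral_mul_const _ measurable_diamCoef.ennreal_ofReal, lintegral_diamCoef, pow_succ']

/-- The expected sum is the geometric series of ratio `5/12`, so the sum is almost surely finite. -/
theorem ae_summable_prodDiam : ∀ᵐ w ∂iidLaw, Summable fun n => prodDiam n w := by
  have h : ∫⁻ w, ∑' n, ENNReal.ofReal (prodDiam n w) ∂iidLaw ≠ ∞ := by
    rw [lintegral_tsum fun n => (measurable_prodDiam n).ennreal_ofReal.aemeasurable]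
    simp only [lintegral_prodDiam]
    rw [ENNReal.tsum_geometric, Ne, ENNReal.inv_eq_top, tsub_eq_zero_iff_le, not_le,
      ← ENNReal.ofReal_one]
    exact (ENNReal.ofReal_lt_ofReal_iff one_pos).2 (by norm_num)
  filter_upwards [ae_lt_top (.tsum fun n => (measurable_prodDiam n).ennreal_ofReal) h] with w hw
  simpa [ENNReal.toReal_ofReal, prodDiam_nonneg] using ENNReal.summable_toReal hw.ne

theorem ae_summable_limitPoint :
    ∀ᵐ w ∂iidLaw, Summable fun n => prodDiam n w * centreCoef (w n) := by
  filter_upwards [ae_summable_prodDiam, ae_iidLaw_mem] with w hw hmem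
  refine .of_norm_bounded hw fun n => ?_
  rw [Real.norm_eq_abs, abs_mul, abs_of_nonneg (prodDiam_nonneg n w)]
  exact mul_le_of_le_one_right (prodDiam_nonneg n w) (abs_centreCoef_le_one (hmem n))

theorem measurable_limitTerm (n : ℕ) :
    Measurable fun w : ℕ → ℝ => prodDiam n w * centreCoef (w n) :=
  (measurable_prodDiam n).mul (measurable_centreCoef.comp (measurable_pi_apply n))

theorem aemeasurable_limitPoint : AEMeasurable limitPoint iidLaw := by
  refine aemeasurable_of_tendsto_metrizable_ae atTop
    (f := fun N w => ∑ n ∈ Finset.range N, prodDiam n w * centreCoef (w n)) (fun N => ?_) ?_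
  · exact (Finset.measurable_sum _ fun n _ => measurable_limitTerm n).aemeasurable
  · filter_upwards [ae_summable_limitPoint] with w hw
    exact hw.hasSum.tendsto_sum_nat

/-- All terms of the series but the first share the factor `diamCoef` of the first variable; what
remains is the series of the shifted sequence. -/
theorem ae_limitPoint_consSeq : ∀ᵐ p ∂uniform01.prod iidLaw,
    limitPoint (consSeq p) = centreCoef p.1 + diamCoef p.1 * limitPoint p.2 := by
  have h := ae_summable_limitPoint
  rw [← map_consSeq] at h
  filter_upwards [ae_of_ae_map measurable_consSeq.aemeasurable h] with p hp
  rw [limitPoint, hp.tsum_eq_zero_add, limitPoint, ← tsum_mul_left]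
  congr 1
  · simp [prodDiam, consSeq]
  · refine tsum_congr fun n => ?_
    rw [prodDiam_consSeq, mul_assoc]
    rfl

/-- The law of the limit of the core, from a core of centre `0` and diameter `1`. -/
def limitLaw : Measure ℝ := iidLaw.map limitPoint

instance isProbabilityMeasure_limitLaw : IsProbabilityMeasure limitLaw :=
  Measure.isProbabilityMeasure_map aemeasurable_limitPoint

theorem limitLaw_eq_fixMap : limitLaw = fixMap limitLaw := by
  refine Measure.ext_of_lintegral _ fun f hf => ?_
  have hc := measurable_centreCoef
  have hd := measurable_diamCoef
  have hL : AEMeasurable (fun p : ℝ × (ℕ → ℝ) => limitPoint p.2) (uniform01.prod iidLaw) :=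
    aemeasurable_limitPoint.comp_snd
  rw [lintegral_fixMap _ hf]
  calc ∫⁻ x, f x ∂limitLaw = ∫⁻ w, f (limitPoint w) ∂iidLaw :=
        lintegral_map' hf.aemeasurable aemeasurable_limitPoint
    _ = ∫⁻ p, f (limitPoint (consSeq p)) ∂uniform01.prod iidLaw := by
        conv_lhs => rw [← map_consSeq]
        refine lintegral_map' ?_ measurable_consSeq.aemeasurable
        rw [map_consSeq]
        exact hf.comp_aemeasurable aemeasurable_limitPoint
    _ = ∫⁻ p, f (centreCoef p.1 + diamCoef p.1 * limitPoint p.2) ∂uniform01.prod iidLaw := by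
        refine lintegral_congr_ae ?_
        filter_upwards [ae_limitPoint_consSeq] with p hp
        rw [hp]
    _ = ∫⁻ v, ∫⁻ w, f (centreCoef v + diamCoef v * limitPoint w) ∂iidLaw ∂uniform01 :=
        lintegral_prod _ (hf.comp_aemeasurable (by fun_prop))
    _ = _ := by
        refine lintegral_congr fun v => ?_
        have hv : Measurable fun l : ℝ => f (centreCoef v + diamCoef v * l) :=
          hf.comp (by fun_prop)
        exact (lintegral_map' hv.aemeasurable aemeasurable_limitPoint).symm

/-! ### Moments -/

/-- Convexity of `exp` between `0` and `s / 2`, together with `exp (1/2) ≤ 2`. The right side is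
affine in `exp (s / 2)`, so its expectation closes a recursion. -/
theorem exp_half_one_add_mul_le {b s : ℝ} (hb0 : 0 ≤ b) (hb1 : b ≤ 1) :
    Real.exp ((1 + b * s) / 2) ≤ 2 * ((1 - b) + b * Real.exp (s / 2)) := by
  have h1 : Real.exp (1 / 2) ≤ 2 := by
    have h := Real.exp_one_lt_d9
    have h' : Real.exp (1 / 2) * Real.exp (1 / 2) = Real.exp 1 := by
      rw [← Real.exp_add]; norm_num
    nlinarith [Real.exp_pos (1 / 2)]
  have h2 := convexOn_exp.2 (Set.mem_univ 0) (Set.mem_univ (s / 2)) (sub_nonneg.2 hb1) hb0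
    (by ring)
  simp only [smul_eq_mul, mul_zero, zero_add, Real.exp_zero, mul_one] at h2
  rw [show (1 + b * s) / 2 = 1 / 2 + b * (s / 2) by ring, Real.exp_add]
  exact mul_le_mul h1 h2 (Real.exp_pos _).le zero_le_two

/-- The partial sums satisfy `S = 1 + B * S'` with `S'` independent of `B`. Taking expectations in
the convexity bound with `E[B] = 5/12` gives `x ↦ 7/6 + 5/6 * x`, whose fixed point is `7`. -/
theorem lintegral_exp_sum_prodDiam_le (n : ℕ) :
    ∫⁻ w, ENNReal.ofReal (Real.exp ((∑ j ∈ Finset.range n, prodDiam j w) / 2)) ∂iidLaw ≤ 7 := by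
  have hm : ∀ n, Measurable fun w : ℕ → ℝ =>
      ENNReal.ofReal (Real.exp ((∑ j ∈ Finset.range n, prodDiam j w) / 2)) := fun n => by
    have := measurable_prodDiam
    fun_prop
  have hsum : ∀ n v w, ∑ j ∈ Finset.range (n + 1), prodDiam j (consSeq (v, w)) =
      1 + diamCoef v * ∑ j ∈ Finset.range n, prodDiam j w := fun n v w => by
    rw [Finset.sum_range_succ', add_comm, Finset.mul_sum]
    simp only [prodDiam_consSeq]
    simp [prodDiam]
  induction n with
  | zero => simp
  | succ n ih =>
    rw [lintegral_iidLaw (hm _)]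
    simp only [hsum]
    have hstep : ∀ᵐ v ∂uniform01, ∫⁻ w, ENNReal.ofReal (Real.exp
        ((1 + diamCoef v * ∑ j ∈ Finset.range n, prodDiam j w) / 2)) ∂iidLaw ≤
        2 + 12 * ENNReal.ofReal (diamCoef v) := by
      filter_upwards [ae_uniform01_mem] with v hv
      have hb0 := diamCoef_nonneg v
      have hb1 := diamCoef_le_one hv
      calc _ ≤ ∫⁻ w, (ENNReal.ofReal (2 * (1 - diamCoef v)) + ENNReal.ofReal (2 * diamCoef v) *
              ENNReal.ofReal (Real.exp ((∑ j ∈ Finset.range n, prodDiam j w) / 2))) ∂iidLaw := by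
            refine lintegral_mono fun w => ?_
            rw [← ENNReal.ofReal_mul (by positivity), ← ENNReal.ofReal_add (by linarith)
              (by positivity)]
            refine ENNReal.ofReal_le_ofReal ((exp_half_one_add_mul_le hb0 hb1).trans_eq (by ring))
        _ = ENNReal.ofReal (2 * (1 - diamCoef v)) + ENNReal.ofReal (2 * diamCoef v) *
              ∫⁻ w, ENNReal.ofReal (Real.exp ((∑ j ∈ Finset.range n, prodDiam j w) / 2))
                ∂iidLaw := by
            rw [lintegral_add_left measurable_const, lintegral_const_mul _ (hm n),
              lintegral_const, measure_univ, mul_one]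
        _ ≤ ENNReal.ofReal (2 * (1 - diamCoef v)) + ENNReal.ofReal (2 * diamCoef v) *
              ENNReal.ofReal 7 := by
            gcongr
            simpa using ih
        _ = 2 + 12 * ENNReal.ofReal (diamCoef v) := by
            rw [← ENNReal.ofReal_mul (by positivity), ← ENNReal.ofReal_add (by linarith)
              (by positivity), show (2 : ℝ≥0∞) = ENNReal.ofReal 2 by simp,
              show (12 : ℝ≥0∞) = ENNReal.ofReal 12 by simp, ← ENNReal.ofReal_mul (by positivity),
              ← ENNReal.ofReal_add (by positivity) (by positivity)]
            congr 1; ring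
    refine (lintegral_mono_ae hstep).trans ?_
    rw [lintegral_add_left measurable_const, lintegral_const, measure_univ, mul_one,
      lintegral_const_mul _ measurable_diamCoef.ennreal_ofReal, lintegral_diamCoef, show (12 : ℝ≥0∞) = ENNReal.ofReal 12 by simp,
      ← ENNReal.ofReal_mul (by positivity)]
    norm_num

/-- Fatou's lemma along the partial sums, each bounded in modulus by the corresponding sum of
diameters. -/
theorem lintegral_exp_limitPoint_le :
    ∫⁻ w, ENNReal.ofReal (Real.exp (|limitPoint w| / 2)) ∂iidLaw ≤ 7 := by
  have hm := measurable_limitTerm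
  let F : ℕ → (ℕ → ℝ) → ℝ≥0∞ := fun N w => ENNReal.ofReal
    (Real.exp (|∑ n ∈ Finset.range N, prodDiam n w * centreCoef (w n)| / 2))
  have hF : ∀ N, Measurable (F N) := fun N => by
    have : Measurable fun w : ℕ → ℝ => ∑ n ∈ Finset.range N, prodDiam n w * centreCoef (w n) :=
      Finset.measurable_sum _ fun n _ => hm n
    fun_prop
  have hlim : ∀ᵐ w ∂iidLaw,
      ENNReal.ofReal (Real.exp (|limitPoint w| / 2)) = liminf (fun N => F N w) atTop := by
    filter_upwards [ae_summable_limitPoint] with w hw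
    refine (Tendsto.liminf_eq ?_).symm
    exact (ENNReal.continuous_ofReal.tendsto _).comp ((Real.continuous_exp.tendsto _).comp
      ((hw.hasSum.tendsto_sum_nat.abs).div_const 2))
  rw [lintegral_congr_ae hlim]
  refine (lintegral_liminf_le hF).trans ?_
  refine liminf_le_of_le (by isBoundedDefault) fun c hc => ?_
  obtain ⟨N, hN⟩ := hc.exists
  refine hN.trans ((lintegral_mono_ae ?_).trans (lintegral_exp_sum_prodDiam_le N))
  filter_upwards [ae_iidLaw_mem] with w hmem
  refine ENNReal.ofReal_le_ofReal (Real.exp_le_exp.2 (div_le_div_of_nonneg_right ?_ zero_le_two))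
  refine (Finset.abs_sum_le_sum_abs _ _).trans (Finset.sum_le_sum fun n _ => ?_)
  rw [abs_mul, abs_of_nonneg (prodDiam_nonneg n w)]
  exact mul_le_of_le_one_right (prodDiam_nonneg n w) (abs_centreCoef_le_one (hmem n))

theorem integrable_abs_pow_limitLaw (k : ℕ) : Integrable (fun x => |x| ^ k) limitLaw := by
  have hexp : Integrable (fun x : ℝ => Real.exp (|x| / 2)) limitLaw := by
    refine ⟨by fun_prop, ?_⟩
    rw [hasFiniteIntegral_iff_ofReal (.of_forall fun x => (Real.exp_pos _).le), limitLaw,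
      lintegral_map' (by fun_prop) aemeasurable_limitPoint]
    exact lintegral_exp_limitPoint_le.trans_lt (by simp)
  refine (hexp.const_mul (2 ^ k * k.factorial)).mono' (by fun_prop) (.of_forall fun x => ?_)
  have h := Real.pow_div_factorial_le_exp (|x| / 2) (by positivity) k
  rw [div_le_iff₀ (by positivity), div_pow, div_le_iff₀ (by positivity)] at h
  rw [Real.norm_of_nonneg (by positivity)]
  linarith

/-! ### Uniqueness of the solution of the fixed-point equation -/

theorem charFun_fixMap (ν : Measure ℝ) [IsProbabilityMeasure ν] (t : ℝ) :
    charFun (fixMap ν) t =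
      ∫ v, Complex.exp (t * centreCoef v * Complex.I) * charFun ν (t * diamCoef v) ∂uniform01 := by
  have hc := measurable_centreCoef
  have hd := measurable_diamCoef
  rw [charFun_apply_real, fixMap_eq_map, integral_map (by fun_prop) (by fun_prop), integral_prod]
  · refine integral_congr_ae (.of_forall fun v => ?_)
    simp only [charFun_apply_real]
    rw [← integral_const_mul]
    refine integral_congr_ae (.of_forall fun l => ?_)
    simp only
    rw [← Complex.exp_add]
    congr 1
    push_cast
    ring
  · refine Integrable.of_bound (by fun_prop) 1 (.of_forall fun p => ?_)
    rw [← Complex.ofReal_mul, Complex.norm_exp_ofReal_mul_I]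

/-- The displacement contributes only a phase of modulus one, common to both solutions, so only the
contraction survives. -/
theorem enorm_charFun_sub_le {ν ν' : Measure ℝ} [IsProbabilityMeasure ν] [IsProbabilityMeasure ν']
    (h : ν = fixMap ν) (h' : ν' = fixMap ν') (t : ℝ) :
    ‖charFun ν t - charFun ν' t‖ₑ ≤
      ∫⁻ v, ‖charFun ν (t * diamCoef v) - charFun ν' (t * diamCoef v)‖ₑ ∂uniform01 := by
  have hc := measurable_centreCoef
  have hd := measurable_diamCoef
  have hint : ∀ (ρ : Measure ℝ) [IsProbabilityMeasure ρ], Integrable (fun v => Complex.exp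
      (t * centreCoef v * Complex.I) * charFun ρ (t * diamCoef v)) uniform01 := fun ρ _ => by
    have := measurable_charFun (μ := ρ)
    refine Integrable.of_bound (by fun_prop) 1 (.of_forall fun v => ?_)
    rw [norm_mul, ← Complex.ofReal_mul, Complex.norm_exp_ofReal_mul_I, one_mul]
    exact norm_charFun_le_one _
  conv_lhs => rw [h, h']
  rw [charFun_fixMap, charFun_fixMap, ← integral_sub (hint ν) (hint ν')]
  refine (enorm_integral_le_lintegral_enorm _).trans (lintegral_mono fun v => ?_)
  rw [← mul_sub, enorm_mul]
  refine le_of_eq ?_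
  rw [← ofReal_norm (Complex.exp _), ← Complex.ofReal_mul, Complex.norm_exp_ofReal_mul_I]
  simp

/-- Let `M` be the maximum over `|t| ≤ T`. The branches with factor `u` contribute at most `2/3 *
M`, those with factor `u / 2` at most `1/3 * c`; thus `M ≤ 2/3 * M + 1/3 * c`, that is `M ≤ c`. -/
theorem norm_charFun_sub_le_of_half {ν ν' : Measure ℝ} [IsProbabilityMeasure ν]
    [IsProbabilityMeasure ν'] (h : ν = fixMap ν) (h' : ν' = fixMap ν') {T c : ℝ} (hT : 0 ≤ T)
    (hhalf : ∀ t, |t| ≤ T / 2 → ‖charFun ν t - charFun ν' t‖ ≤ c) {t : ℝ} (ht : |t| ≤ T) :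
    ‖charFun ν t - charFun ν' t‖ ≤ c := by
  have hcont : Continuous fun t : ℝ => ‖charFun ν t - charFun ν' t‖ :=
    (continuous_charFun.sub continuous_charFun).norm
  have hc0 : 0 ≤ c := (norm_nonneg _).trans (hhalf 0 (by simp; linarith))
  obtain ⟨s, hs, hmax⟩ := (isCompact_Icc (a := -T) (b := T)).exists_isMaxOn
    ⟨0, by simp [hT]⟩ hcont.continuousOn
  set M := ‖charFun ν s - charFun ν' s‖
  have hle : ∀ t, |t| ≤ T → ‖charFun ν t - charFun ν' t‖ ≤ M := fun t ht => hmax (abs_le.1 ht)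
  have hsT : |s| ≤ T := abs_le.2 hs
  have key : ENNReal.ofReal M ≤ ENNReal.ofReal (2 / 3 * M + 1 / 3 * c) := by
    have h1 : ∫⁻ u, ‖charFun ν (s * u) - charFun ν' (s * u)‖ₑ ∂uniform01 ≤ ENNReal.ofReal M := by
      refine (lintegral_mono_ae (g := fun _ => ENNReal.ofReal M) ?_).trans_eq (by simp)
      filter_upwards [ae_uniform01_mem] with u hu
      rw [← ofReal_norm]
      refine ENNReal.ofReal_le_ofReal (hle _ ?_)
      rw [abs_mul, abs_of_nonneg hu.1]
      exact (mul_le_of_le_one_right (abs_nonneg s) hu.2).trans hsT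
    have h2 : ∫⁻ u, ‖charFun ν (s * (u / 2)) - charFun ν' (s * (u / 2))‖ₑ ∂uniform01 ≤
        ENNReal.ofReal c := by
      refine (lintegral_mono_ae (g := fun _ => ENNReal.ofReal c) ?_).trans_eq (by simp)
      filter_upwards [ae_uniform01_mem] with u hu
      rw [← ofReal_norm]
      refine ENNReal.ofReal_le_ofReal (hhalf _ ?_)
      rw [abs_mul, abs_of_nonneg (show 0 ≤ u / 2 by linarith [hu.1])]
      nlinarith [abs_nonneg s, hu.1, hu.2]
    have h3 : (1 / 3 : ℝ≥0∞) = ENNReal.ofReal (1 / 3) := by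
      rw [ENNReal.ofReal_div_of_pos (by norm_num)]; simp
    have h6 : (1 / 6 : ℝ≥0∞) = ENNReal.ofReal (1 / 6) := by
      rw [ENNReal.ofReal_div_of_pos (by norm_num)]; simp
    have hM0 : 0 ≤ M := norm_nonneg _
    calc ENNReal.ofReal M = ‖charFun ν s - charFun ν' s‖ₑ := ofReal_norm _
      _ ≤ _ := enorm_charFun_sub_le h h' s
      _ = _ := lintegral_coef fun _ b => ‖charFun ν (s * b) - charFun ν' (s * b)‖ₑ
      _ ≤ 1 / 3 * ENNReal.ofReal M + 1 / 6 * ENNReal.ofReal c + 1 / 6 * ENNReal.ofReal c +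
          1 / 3 * ENNReal.ofReal M := by gcongr
      _ = _ := by
        rw [h3, h6, ← ENNReal.ofReal_mul (by norm_num), ← ENNReal.ofReal_mul (by norm_num),
          ← ENNReal.ofReal_add (by positivity) (by positivity),
          ← ENNReal.ofReal_add (by positivity) (by positivity),
          ← ENNReal.ofReal_add (by positivity) (by positivity)]
        congr 1; ring
  have h4 := (ENNReal.ofReal_le_ofReal_iff (by positivity)).1 key
  exact (hle t ht).trans (by linarith)

/-- Both characteristic functions equal `1` at `0`, so their difference is at most `ε` near `0`;
repeated doubling of the interval carries this bound to the whole line. -/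
theorem eq_of_eq_fixMap {ν ν' : Measure ℝ} [IsProbabilityMeasure ν] [IsProbabilityMeasure ν']
    (h : ν = fixMap ν) (h' : ν' = fixMap ν') : ν = ν' := by
  refine Measure.ext_of_charFun (funext fun t => sub_eq_zero.1 (norm_le_zero_iff.1 ?_))
  refine le_of_forall_pos_le_add fun ε hε => ?_
  rw [zero_add]
  have hcont : Continuous fun t : ℝ => ‖charFun ν t - charFun ν' t‖ :=
    (continuous_charFun.sub continuous_charFun).norm
  have h0 : Tendsto (fun t : ℝ => ‖charFun ν t - charFun ν' t‖) (𝓝 0) (𝓝 0) := by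
    simpa using hcont.tendsto 0
  obtain ⟨δ, hδ, hball⟩ := Metric.eventually_nhds_iff.1 (h0.eventually (ge_mem_nhds hε))
  have hind : ∀ n : ℕ, ∀ t, |t| ≤ δ / 2 * 2 ^ n → ‖charFun ν t - charFun ν' t‖ ≤ ε := by
    intro n
    induction n with
    | zero =>
      intro t ht
      refine hball ?_
      rw [Real.dist_eq, sub_zero]
      linarith
    | succ n ih =>
      intro t ht
      refine norm_charFun_sub_le_of_half h h' (by positivity) (fun s hs => ih s ?_) ht
      rw [pow_succ] at hs
      linarith
  obtain ⟨n, hn⟩ := pow_unbounded_of_one_lt (|t| / (δ / 2)) one_lt_two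
  exact hind n t ((div_le_iff₀' (by positivity)).1 hn.le)

theorem fixMap_map_neg (ν : Measure ℝ) [IsProbabilityMeasure ν] :
    fixMap (ν.map fun x => -x) = (fixMap ν).map fun x => -x := by
  have : IsProbabilityMeasure (ν.map fun x => -x) :=
    Measure.isProbabilityMeasure_map measurable_neg.aemeasurable
  refine Measure.ext_of_lintegral _ fun f hf => ?_
  rw [lintegral_map hf measurable_neg, lintegral_fixMap _ hf,
    lintegral_fixMap ν (f := fun x => f (-x)) (hf.comp measurable_neg)]
  have h1 : ∀ a b : ℝ, ∫⁻ l, f (a + b * l) ∂(ν.map fun x => -x) = ∫⁻ l, f (a + b * -l) ∂ν :=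
    fun a b => by
      have hab : Measurable fun l : ℝ => f (a + b * l) := hf.comp (by fun_prop)
      exact lintegral_map hab measurable_neg
  simp only [h1]
  rw [lintegral_coef fun a b => ∫⁻ l, f (a + b * -l) ∂ν,
    lintegral_coef fun a b => ∫⁻ l, f (-(a + b * l)) ∂ν]
  simp only [neg_add, neg_neg, mul_neg]
  abel

/-- The branches are exchanged in pairs by reflection, so the reflected law is again a solution, and
uniqueness applies. -/
theorem map_neg_eq_of_eq_fixMap {ν : Measure ℝ} [IsProbabilityMeasure ν] (h : ν = fixMap ν) :
    ν.map (fun x => -x) = ν := by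
  have : IsProbabilityMeasure (ν.map fun x => -x) :=
    Measure.isProbabilityMeasure_map measurable_neg.aemeasurable
  refine eq_of_eq_fixMap ?_ h
  rw [fixMap_map_neg, ← h]

/-! ### Moments of the solution -/

theorem integral_pow_eq_zero_of_odd {ν : Measure ℝ} (h : ν.map (fun x => -x) = ν) {k : ℕ}
    (hk : Odd k) : ∫ x, x ^ k ∂ν = 0 := by
  have h1 : ∫ x, x ^ k ∂ν = ∫ x, (-x) ^ k ∂ν := by
    conv_lhs => rw [← h]
    exact integral_map measurable_neg.aemeasurable (by fun_prop)
  simp only [hk.neg_pow, integral_neg] at h1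
  linarith

theorem integrable_pow_of_abs {ν : Measure ℝ} {k : ℕ} (h : Integrable (fun x => |x| ^ k) ν) :
    Integrable (fun x => x ^ k) ν :=
  h.mono (by fun_prop) (.of_forall fun x => by simp)

theorem integral_add_mul_pow {ν : Measure ℝ} (hν : ∀ k : ℕ, Integrable (fun x => |x| ^ k) ν)
    (a b : ℝ) (k : ℕ) : ∫ l, (a + b * l) ^ k ∂ν =
      ∑ j ∈ Finset.range (k + 1), k.choose j * (a ^ (k - j) * b ^ j) * ∫ l, l ^ j ∂ν := by
  have h : ∀ l, (a + b * l) ^ k =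
      ∑ j ∈ Finset.range (k + 1), k.choose j * (a ^ (k - j) * b ^ j) * l ^ j := fun l => by
    rw [add_comm, add_pow]
    exact Finset.sum_congr rfl fun j _ => by rw [mul_pow]; ring
  simp only [h]
  rw [integral_finsetSum _ fun j _ => (integrable_pow_of_abs (hν j)).const_mul _]
  simp only [integral_const_mul]

theorem map_coef : uniform01.map (fun v => (centreCoef v, diamCoef v)) =
    (1 / 3 : ℝ≥0∞) • uniform01.map (fun u => (-((1 + u) / 2), u)) +
    (1 / 6 : ℝ≥0∞) • uniform01.map (fun u => (-((2 - u) / 4), u / 2)) +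
    (1 / 6 : ℝ≥0∞) • uniform01.map (fun u => ((2 - u) / 4, u / 2)) +
    (1 / 3 : ℝ≥0∞) • uniform01.map (fun u => ((1 + u) / 2, u)) := by
  refine Measure.ext_of_lintegral _ fun f hf => ?_
  rw [lintegral_map hf (measurable_centreCoef.prodMk measurable_diamCoef),
    lintegral_coef fun a b => f (a, b)]
  simp only [lintegral_add_measure, lintegral_smul_measure, smul_eq_mul]
  rw [lintegral_map hf (by fun_prop), lintegral_map hf (by fun_prop), lintegral_map hf (by fun_prop),
    lintegral_map hf (by fun_prop)]

theorem integral_coef {g : ℝ × ℝ → ℝ} (hg : Continuous g) :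
    ∫ v, g (centreCoef v, diamCoef v) ∂uniform01 =
      1 / 3 * (∫ u in (0 : ℝ)..1, g (-((1 + u) / 2), u)) +
      1 / 6 * (∫ u in (0 : ℝ)..1, g (-((2 - u) / 4), u / 2)) +
      1 / 6 * (∫ u in (0 : ℝ)..1, g ((2 - u) / 4, u / 2)) +
      1 / 3 * (∫ u in (0 : ℝ)..1, g ((1 + u) / 2, u)) := by
  have hint : ∀ (c : ℝ≥0∞) (φ : ℝ → ℝ × ℝ), c ≠ ∞ → Continuous φ →
      Integrable g (c • uniform01.map φ) := fun c φ hc hφ => by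
    refine Integrable.smul_measure ?_ hc
    rw [integrable_map_measure hg.aestronglyMeasurable hφ.aemeasurable]
    exact (hg.comp hφ).integrableOn_Icc
  have hval : ∀ (c : ℝ≥0∞) (φ : ℝ → ℝ × ℝ), Continuous φ →
      ∫ p, g p ∂(c • uniform01.map φ) = c.toReal * ∫ u in (0 : ℝ)..1, g (φ u) := fun c φ hφ => by
    rw [integral_smul_measure, integral_map hφ.aemeasurable hg.aestronglyMeasurable,
      integral_uniform01, smul_eq_mul]
  have t3 : (1 / 3 : ℝ≥0∞) ≠ ∞ := by simp
  have t6 : (1 / 6 : ℝ≥0∞) ≠ ∞ := by simp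
  have i1 := hint (1 / 3) (fun u => (-((1 + u) / 2), u)) t3 (by fun_prop)
  have i2 := hint (1 / 6) (fun u => (-((2 - u) / 4), u / 2)) t6 (by fun_prop)
  have i3 := hint (1 / 6) (fun u => ((2 - u) / 4, u / 2)) t6 (by fun_prop)
  have i4 := hint (1 / 3) (fun u => ((1 + u) / 2, u)) t3 (by fun_prop)
  rw [← integral_map (φ := fun v => (centreCoef v, diamCoef v)) (f := g)
    (measurable_centreCoef.prodMk measurable_diamCoef).aemeasurable hg.aestronglyMeasurable,
    map_coef, integral_add_measure ((i1.add_measure i2).add_measure i3) i4,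
    integral_add_measure (i1.add_measure i2) i3, integral_add_measure i1 i2,
    hval _ _ (by fun_prop), hval _ _ (by fun_prop), hval _ _ (by fun_prop), hval _ _ (by fun_prop)]
  simp

/-- The contribution of displacement `a` and contraction `b` to the moment of order `k` of a
solution `ν` of the fixed-point equation. -/
def branchMoment (ν : Measure ℝ) (k : ℕ) (p : ℝ × ℝ) : ℝ :=
  ∑ j ∈ Finset.range (k + 1), k.choose j * (p.1 ^ (k - j) * p.2 ^ j) * ∫ l, l ^ j ∂ν

theorem integral_pow_eq_branchMoment {ν : Measure ℝ} [IsProbabilityMeasure ν] (h : ν = fixMap ν)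
    (hν : ∀ k : ℕ, Integrable (fun x => |x| ^ k) ν) {k : ℕ} (hk : Even k) :
    ∫ x, x ^ k ∂ν = 2 / 3 * (∫ u in (0 : ℝ)..1, branchMoment ν k ((1 + u) / 2, u)) +
      1 / 3 * (∫ u in (0 : ℝ)..1, branchMoment ν k ((2 - u) / 4, u / 2)) := by
  have hc := measurable_centreCoef
  have hd := measurable_diamCoef
  have hm : Measurable fun p : ℝ × ℝ => centreCoef p.1 + diamCoef p.1 * p.2 := by fun_prop
  have hcont : Continuous (branchMoment ν k) := by unfold branchMoment; fun_prop
  have hint := integrable_pow_of_abs (hν k)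
  -- For even `k` the terms odd in `a` carry an odd moment of `ν`, which vanishes. The four branches
  -- therefore pair up.
  have hsymm : ∀ a b, branchMoment ν k (-a, b) = branchMoment ν k (a, b) := fun a b => by
    refine Finset.sum_congr rfl fun j hj => ?_
    rcases Nat.even_or_odd j with hj' | hj'
    · rw [((Nat.even_sub (Nat.lt_succ_iff.1 (Finset.mem_range.1 hj))).2 (by simp [hk, hj'])).neg_pow]
    · rw [integral_pow_eq_zero_of_odd (map_neg_eq_of_eq_fixMap h) hj', mul_zero, mul_zero]
  have h1 : ∫ x, x ^ k ∂ν = ∫ v, branchMoment ν k (centreCoef v, diamCoef v) ∂uniform01 := by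
    rw [h, fixMap_eq_map, integrable_map_measure (by fun_prop) hm.aemeasurable] at hint
    conv_lhs => rw [h, fixMap_eq_map]
    rw [integral_map hm.aemeasurable (by fun_prop)]
    refine (integral_prod _ hint).trans ?_
    exact integral_congr_ae (.of_forall fun v => integral_add_mul_pow hν (centreCoef v) (diamCoef v) k)
  rw [h1, integral_coef hcont]
  simp only [hsymm]
  ring

theorem integral_of_eq_poly {f : ℝ → ℝ} (x y c₀ c₁ c₂ c₃ c₄ c₅ c₆ : ℝ)
    (h : ∀ u, f u = c₀ + c₁ * u + c₂ * u ^ 2 + c₃ * u ^ 3 + c₄ * u ^ 4 + c₅ * u ^ 5 + c₆ * u ^ 6) :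
    ∫ u in x..y, f u = c₀ * (y - x) + c₁ / 2 * (y ^ 2 - x ^ 2) + c₂ / 3 * (y ^ 3 - x ^ 3) +
      c₃ / 4 * (y ^ 4 - x ^ 4) + c₄ / 5 * (y ^ 5 - x ^ 5) + c₅ / 6 * (y ^ 6 - x ^ 6) +
      c₆ / 7 * (y ^ 7 - x ^ 7) := by
  let F : ℝ → ℝ := fun u => c₀ * u + c₁ / 2 * u ^ 2 + c₂ / 3 * u ^ 3 + c₃ / 4 * u ^ 4 +
    c₄ / 5 * u ^ 5 + c₅ / 6 * u ^ 6 + c₆ / 7 * u ^ 7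
  have hF : ∀ u ∈ Set.uIcc x y, HasDerivAt F (f u) u := fun u _ => by
    rw [h]
    have hp : ∀ (c : ℝ) (n : ℕ), HasDerivAt (fun u : ℝ => c * u ^ n) (c * (n * u ^ (n - 1))) u :=
      fun c n => (hasDerivAt_pow n u).const_mul c
    convert! ((((((((hasDerivAt_id u).const_mul c₀).add (hp (c₁ / 2) 2)).add (hp (c₂ / 3) 3)).add
      (hp (c₃ / 4) 4)).add (hp (c₄ / 5) 5)).add (hp (c₅ / 6) 6)).add (hp (c₆ / 7) 7)) using 1
    norm_num
    ring
  have hc : Continuous f := by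
    rw [funext h]; fun_prop
  rw [intervalIntegral.integral_eq_sub_of_hasDerivAt hF (hc.intervalIntegrable x y)]
  simp only [F]
  ring

theorem integral_sq_eq {ν : Measure ℝ} [IsProbabilityMeasure ν] (h : ν = fixMap ν)
    (hν : ∀ k : ℕ, Integrable (fun x => |x| ^ k) ν) : ∫ x, x ^ 2 ∂ν = 7 / 12 := by
  have hs := map_neg_eq_of_eq_fixMap h
  have o1 : ∫ x, x ∂ν = 0 := by simpa using integral_pow_eq_zero_of_odd hs odd_one
  have e := integral_pow_eq_branchMoment h hν (k := 2) (by decide)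
  simp only [branchMoment, Finset.sum_range_succ, Finset.sum_range_zero, Nat.choose, pow_zero, pow_one,
    integral_const, probReal_univ, smul_eq_mul, o1] at e
  set θ₂ := ∫ x, x ^ 2 ∂ν
  -- The arguments are the coefficients, in powers of `u`, of the binomial expansion on each branch.
  -- The unknown moment reappears on the right with a factor below `1`, so the resulting linear
  -- equation determines it; the higher moments below work alike.
  rw [integral_of_eq_poly 0 1
      ((1 / 4)) ((1 / 2)) ((1 / 4) + (1) * θ₂) 0 0 0 0
      (fun u => by norm_num; ring),
    integral_of_eq_poly 0 1
      ((1 / 4)) ((-1 / 4)) ((1 / 16) + (1 / 4) * θ₂) 0 0 0 0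
      (fun u => by norm_num; ring)] at e
  linarith

theorem integral_pow_four_eq {ν : Measure ℝ} [IsProbabilityMeasure ν] (h : ν = fixMap ν)
    (hν : ∀ k : ℕ, Integrable (fun x => |x| ^ k) ν) : ∫ x, x ^ 4 ∂ν = 375 / 368 := by
  have hs := map_neg_eq_of_eq_fixMap h
  have o1 : ∫ x, x ∂ν = 0 := by simpa using integral_pow_eq_zero_of_odd hs odd_one
  have o3 : ∫ x, x ^ 3 ∂ν = 0 := integral_pow_eq_zero_of_odd hs (by decide)
  have e2 := integral_sq_eq h hν
  have e := integral_pow_eq_branchMoment h hν (k := 4) (by decide)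
  simp only [branchMoment, Finset.sum_range_succ, Finset.sum_range_zero, Nat.choose, pow_zero, pow_one,
    integral_const, probReal_univ, smul_eq_mul, o1, o3] at e
  set θ₂ := ∫ x, x ^ 2 ∂ν
  set θ₄ := ∫ x, x ^ 4 ∂ν
  rw [integral_of_eq_poly 0 1
      ((1 / 16)) ((1 / 4)) ((3 / 8) + (3 / 2) * θ₂) ((1 / 4) + (3) * θ₂) ((1 / 16) + (3 / 2) * θ₂ + (1) * θ₄) 0 0
      (fun u => by norm_num; ring),
    integral_of_eq_poly 0 1
      ((1 / 16)) ((-1 / 8)) ((3 / 32) + (3 / 8) * θ₂) ((-1 / 32) + (-3 / 8) * θ₂) ((1 / 256) + (3 / 32) * θ₂ + (1 / 16) * θ₄) 0 0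
      (fun u => by norm_num; ring)] at e
  linarith

theorem integral_pow_six_eq {ν : Measure ℝ} [IsProbabilityMeasure ν] (h : ν = fixMap ν)
    (hν : ∀ k : ℕ, Integrable (fun x => |x| ^ k) ν) : ∫ x, x ^ 6 ∂ν = 76693 / 22080 := by
  have hs := map_neg_eq_of_eq_fixMap h
  have o1 : ∫ x, x ∂ν = 0 := by simpa using integral_pow_eq_zero_of_odd hs odd_one
  have o3 : ∫ x, x ^ 3 ∂ν = 0 := integral_pow_eq_zero_of_odd hs (by decide)
  have o5 : ∫ x, x ^ 5 ∂ν = 0 := integral_pow_eq_zero_of_odd hs (by decide)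
  have e2 := integral_sq_eq h hν
  have e4 := integral_pow_four_eq h hν
  have e := integral_pow_eq_branchMoment h hν (k := 6) (by decide)
  simp only [branchMoment, Finset.sum_range_succ, Finset.sum_range_zero, Nat.choose, pow_zero, pow_one,
    integral_const, probReal_univ, smul_eq_mul, o1, o3, o5] at e
  set θ₂ := ∫ x, x ^ 2 ∂ν
  set θ₄ := ∫ x, x ^ 4 ∂ν
  set θ₆ := ∫ x, x ^ 6 ∂ν
  rw [integral_of_eq_poly 0 1
      ((1 / 64)) ((3 / 32)) ((15 / 64) + (15 / 16) * θ₂) ((5 / 16) + (15 / 4) * θ₂) ((15 / 64) + (45 / 8) * θ₂ + (15 / 4) * θ₄) ((3 / 32) + (15 / 4) * θ₂ + (15 / 2) * θ₄) ((1 / 64) + (15 / 16) * θ₂ + (15 / 4) * θ₄ + (1) * θ₆)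
      (fun u => by norm_num; ring),
    integral_of_eq_poly 0 1
      ((1 / 64)) ((-3 / 64)) ((15 / 256) + (15 / 64) * θ₂) ((-5 / 128) + (-15 / 32) * θ₂) ((15 / 1024) + (45 / 128) * θ₂ + (15 / 64) * θ₄) ((-3 / 1024) + (-15 / 128) * θ₂ + (-15 / 64) * θ₄) ((1 / 4096) + (15 / 1024) * θ₂ + (15 / 256) * θ₄ + (1 / 64) * θ₆)
      (fun u => by norm_num; ring)] at e
  linarith

/-! ### The limit of the core -/

section Limit

variable {Ω : Type*} [MeasurableSpace Ω] {P : Measure Ω}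
  {α : Measure (Fin 3 → ℝ)} {X : ℕ → Ω → Fin 3 → ℝ}

theorem ae_summable_of_tsum_lintegral_ne_top {f : ℕ → Ω → ℝ} (hf : ∀ n, AEMeasurable (f n) P)
    (h0 : ∀ n ω, 0 ≤ f n ω) (h : ∑' n, ∫⁻ ω, ENNReal.ofReal (f n ω) ∂P ≠ ∞) :
    ∀ᵐ ω ∂P, Summable fun n => f n ω := by
  rw [← lintegral_tsum fun n => (hf n).ennreal_ofReal] at h
  filter_upwards [ae_lt_top' (AEMeasurable.tsum fun n => (hf n).ennreal_ofReal) h] with ω hω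
  simpa [ENNReal.toReal_ofReal, h0] using ENNReal.summable_toReal hω.ne

theorem IsModifiedProcess.aemeasurable (hX : IsModifiedProcess P α X) (t : ℕ) :
    AEMeasurable (X t) P := by
  cases t with
  | zero => exact hX.initial.aemeasurable
  | succ t => exact (hX.step t).aemeasurable_snd

theorem IsModifiedProcess.aemeasurable_coreStat (hX : IsModifiedProcess P α X) (t : ℕ) :
    AEMeasurable (fun ω => coreStat (X t ω)) P :=
  measurable_coreStat.comp_aemeasurable (hX.aemeasurable t)

variable [IsProbabilityMeasure P]

/-- The step kernel depends on the history only through its last entry, so the rest of the history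
can be projected away. -/
theorem IsModifiedProcess.map_pair (hX : IsModifiedProcess P α X) (t : ℕ) :
    P.map (fun ω => (X t ω, X (t + 1) ω)) = P.map (X t) ⊗ₘ stepKernel :=
  ((hX.step t).comp_right (hf := measurable_pi_apply _)).map_eq

theorem IsModifiedProcess.lintegral_step (hX : IsModifiedProcess P α X) (t : ℕ)
    {g : (ℝ × ℝ) × ℝ × ℝ → ℝ≥0∞} (hg : Measurable g) :
    ∫⁻ ω, g (coreStat (X t ω), coreStat (X (t + 1) ω)) ∂P =
      ∫⁻ ω, ∫⁻ v, g (coreStat (X t ω), nextStat (coreStat (X t ω)) v) ∂uniform01 ∂P := by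
  have hs := measurable_coreStat
  have hG : Measurable fun p : (Fin 3 → ℝ) × (Fin 3 → ℝ) => g (coreStat p.1, coreStat p.2) := by
    fun_prop
  have hn := measurable_nextStat
  have hN : Measurable fun p : (Fin 3 → ℝ) × ℝ =>
      g (coreStat p.1, nextStat (coreStat p.1) p.2) :=
    hg.comp ((hs.comp measurable_fst).prodMk
      (hn.comp ((hs.comp measurable_fst).prodMk measurable_snd)))
  calc ∫⁻ ω, g (coreStat (X t ω), coreStat (X (t + 1) ω)) ∂P
      = ∫⁻ p, g (coreStat p.1, coreStat p.2) ∂P.map (fun ω => (X t ω, X (t + 1) ω)) :=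
        (lintegral_map' hG.aemeasurable
          ((hX.aemeasurable t).prodMk (hX.aemeasurable (t + 1)))).symm
    _ = ∫⁻ x, ∫⁻ y, g (coreStat x, coreStat y) ∂stepLaw x ∂P.map (X t) := by
        rw [hX.map_pair, Measure.lintegral_compProd hG]
        rfl
    _ = ∫⁻ x, ∫⁻ v, g (coreStat x, nextStat (coreStat x) v) ∂uniform01 ∂P.map (X t) := by
        refine lintegral_congr fun x => ?_
        exact lintegral_coreStat_stepLaw x (g := fun s => g (coreStat x, s))
          (hg.comp measurable_prodMk_left)
    _ = _ := lintegral_map' hN.lintegral_prod_right'.aemeasurable (hX.aemeasurable t)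

theorem coreStat_snd_nonneg (x : Fin 3 → ℝ) : 0 ≤ (coreStat x).2 := abs_nonneg _

theorem IsModifiedProcess.lintegral_diam (hX : IsModifiedProcess P α X) (t : ℕ) :
    ∫⁻ ω, ENNReal.ofReal (coreStat (X t ω)).2 ∂P =
      ENNReal.ofReal (5 / 12) ^ t * ∫⁻ ω, ENNReal.ofReal (coreStat (X 0 ω)).2 ∂P := by
  induction t with
  | zero => simp
  | succ t ih =>
    rw [hX.lintegral_step t (g := fun p => ENNReal.ofReal p.2.2) (by fun_prop)]
    simp only [nextStat, ENNReal.ofReal_mul (coreStat_snd_nonneg _)]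
    simp only [lintegral_const_mul _ measurable_diamCoef.ennreal_ofReal, lintegral_diamCoef]
    rw [lintegral_mul_const' _ _ ENNReal.ofReal_ne_top, ih, pow_succ]
    ring

theorem IsModifiedProcess.lintegral_centre_sub_le (hX : IsModifiedProcess P α X) (t : ℕ) :
    ∫⁻ ω, ENNReal.ofReal |(coreStat (X t ω)).1 - (coreStat (X (t + 1) ω)).1| ∂P ≤
      ∫⁻ ω, ENNReal.ofReal (coreStat (X t ω)).2 ∂P := by
  rw [hX.lintegral_step t (g := fun p => ENNReal.ofReal |p.1.1 - p.2.1|) (by fun_prop)]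
  refine lintegral_mono fun ω => ?_
  refine (lintegral_mono_ae (g := fun _ => ENNReal.ofReal (coreStat (X t ω)).2) ?_).trans_eq
    (by simp)
  filter_upwards [ae_uniform01_mem] with v hv
  refine ENNReal.ofReal_le_ofReal ?_
  rw [nextStat, sub_add_cancel_left, abs_neg, abs_mul, abs_of_nonneg (coreStat_snd_nonneg _)]
  exact mul_le_of_le_one_right (coreStat_snd_nonneg _) (abs_centreCoef_le_one hv)

theorem IsModifiedProcess.tsum_lintegral_diam_ne_top (hX : IsModifiedProcess P α X)
    (h0 : ∫⁻ ω, ENNReal.ofReal (coreStat (X 0 ω)).2 ∂P ≠ ∞) :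
    ∑' t, ∫⁻ ω, ENNReal.ofReal (coreStat (X t ω)).2 ∂P ≠ ∞ := by
  rw [tsum_congr fun t => hX.lintegral_diam t, ENNReal.tsum_mul_right, ENNReal.tsum_geometric]
  refine ENNReal.mul_ne_top ?_ h0
  rw [Ne, ENNReal.inv_eq_top, tsub_eq_zero_iff_le, not_le, ← ENNReal.ofReal_one]
  exact (ENNReal.ofReal_lt_ofReal_iff one_pos).2 (by norm_num)

theorem abs_core_sub_bary (x : Fin 3 → ℝ) (i : Fin 2) :
    |core x i - (coreStat x).1| = (coreStat x).2 / 2 := by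
  have h1 : (coreStat x).1 = (x 0 + x 1) / 2 := by
    simp [coreStat, bary, core]
  have h2 : (coreStat x).2 = |x 0 - x 1| := rfl
  rw [h1, h2, ← abs_of_pos (zero_lt_two (α := ℝ)), ← abs_div, abs_of_pos (zero_lt_two (α := ℝ))]
  fin_cases i
  · change |x 0 - _| = _
    congr 1; ring
  · change |x 1 - _| = _
    rw [← abs_neg]
    congr 1; ring

/-- The diameters are almost surely summable, since their means decay geometrically; they dominate
the displacements of the centre in mean, so the centres form a Cauchy sequence. -/
theorem IsModifiedProcess.exists_limit (hX : IsModifiedProcess P α X)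
    (h0 : ∫⁻ ω, ENNReal.ofReal (coreStat (X 0 ω)).2 ∂P ≠ ∞) :
    ∃ ξ : Ω → ℝ, Measurable ξ ∧
      ∀ᵐ ω ∂P, Tendsto (fun t => coreStat (X t ω)) atTop (𝓝 (ξ ω, 0)) := by
  have hd := ae_summable_of_tsum_lintegral_ne_top (fun t => (hX.aemeasurable_coreStat t).snd)
    (fun t ω => coreStat_snd_nonneg _) (hX.tsum_lintegral_diam_ne_top h0)
  have hm := ae_summable_of_tsum_lintegral_ne_top
    (f := fun t ω => |(coreStat (X t ω)).1 - (coreStat (X (t + 1) ω)).1|)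
    (fun t => ((hX.aemeasurable_coreStat t).fst.sub (hX.aemeasurable_coreStat (t + 1)).fst).abs)
    (fun t ω => abs_nonneg _)
    (ne_top_of_le_ne_top (hX.tsum_lintegral_diam_ne_top h0)
      (ENNReal.tsum_le_tsum fun t => hX.lintegral_centre_sub_le t))
  obtain ⟨ξ, hξ, hlim⟩ := measurable_limit_of_tendsto_metrizable_ae (L := atTop)
    (fun t => (hX.aemeasurable_coreStat t).fst) (by
      filter_upwards [hm] with ω hω
      exact cauchySeq_tendsto_of_complete (cauchySeq_of_summable_dist hω))
  refine ⟨ξ, hξ, ?_⟩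
  filter_upwards [hd, hlim] with ω h1 h2
  exact h2.prodMk_nhds h1.tendsto_atTop_zero

theorem tendsto_core_of_tendsto_coreStat {x : ℕ → Fin 3 → ℝ} {c : ℝ}
    (h : Tendsto (fun t => coreStat (x t)) atTop (𝓝 (c, 0))) :
    Tendsto (fun t => core (x t)) atTop (𝓝 fun _ => c) := by
  refine tendsto_pi_nhds.2 fun i => ?_
  have h1 : Tendsto (fun t => (coreStat (x t)).1) atTop (𝓝 c) := h.fst_nhds
  have h2 : Tendsto (fun t => (coreStat (x t)).2 / 2) atTop (𝓝 0) := by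
    simpa using h.snd_nhds.div_const 2
  have h3 : Tendsto (fun t => core (x t) i - (coreStat (x t)).1) atTop (𝓝 0) :=
    squeeze_zero_norm (fun t => (abs_core_sub_bary (x t) i).le) h2
  simpa using h3.add h1

/-- For bounded continuous `f` and `L` of law `ν` independent of the process, `E[f (m + d * L)]` is
constant in time; since `d` tends to `0`, dominated convergence identifies it with `E[f ξ]`. -/
theorem IsModifiedProcess.map_limit (hX : IsModifiedProcess P α X) {ν : Measure ℝ}
    [IsProbabilityMeasure ν] (hν : ν = fixMap ν) {ξ : Ω → ℝ} (hξ : Measurable ξ)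
    (hlim : ∀ᵐ ω ∂P, Tendsto (fun t => coreStat (X t ω)) atTop (𝓝 (ξ ω, 0))) :
    P.map ξ = ((P.map fun ω => coreStat (X 0 ω)).prod ν).map fun q => q.1.1 + q.1.2 * q.2 := by
  have := Measure.isProbabilityMeasure_map (μ := P) hξ.aemeasurable
  refine ext_of_forall_lintegral_eq_of_IsFiniteMeasure fun f => ?_
  have hf : Measurable fun x => (f x : ℝ≥0∞) := f.continuous.measurable.coe_nnreal_ennreal
  have hF : Measurable fun q : (ℝ × ℝ) × ℝ => (f (q.1.1 + q.1.2 * q.2) : ℝ≥0∞) :=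
    hf.comp (by fun_prop)
  have hH : Measurable fun s : ℝ × ℝ => ∫⁻ l, (f (s.1 + s.2 * l) : ℝ≥0∞) ∂ν :=
    hF.lintegral_prod_right'
  have hconst : ∀ t, ∫⁻ ω, ∫⁻ l, (f ((coreStat (X t ω)).1 + (coreStat (X t ω)).2 * l) : ℝ≥0∞) ∂ν ∂P =
      ∫⁻ ω, ∫⁻ l, (f ((coreStat (X 0 ω)).1 + (coreStat (X 0 ω)).2 * l) : ℝ≥0∞) ∂ν ∂P := by
    intro t
    induction t with
    | zero => rfl
    | succ t ih =>
      rw [← ih]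
      refine (hX.lintegral_step t
        (g := fun p => ∫⁻ l, (f (p.2.1 + p.2.2 * l) : ℝ≥0∞) ∂ν) (hH.comp measurable_snd)).trans ?_
      refine lintegral_congr fun ω => ?_
      have hg : Measurable fun l : ℝ =>
          (f ((coreStat (X t ω)).1 + (coreStat (X t ω)).2 * l) : ℝ≥0∞) := hf.comp (by fun_prop)
      -- Expanding `L` as `A + B * L` on the earlier side turns `m + d * L` into the expression
      -- after one step.
      conv_rhs => rw [hν]
      rw [lintegral_fixMap ν hg]
      refine lintegral_congr fun v => lintegral_congr fun l => ?_
      rw [nextStat]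
      congr 2
      ring
  have hjoint : ∀ t, AEMeasurable (fun q : Ω × ℝ =>
      (f ((coreStat (X t q.1)).1 + (coreStat (X t q.1)).2 * q.2) : ℝ≥0∞)) (P.prod ν) := fun t =>
    hF.comp_aemeasurable ((hX.aemeasurable_coreStat t).comp_fst.prodMk measurable_snd.aemeasurable)
  have htend : Tendsto (fun t => ∫⁻ q : Ω × ℝ,
      (f ((coreStat (X t q.1)).1 + (coreStat (X t q.1)).2 * q.2) : ℝ≥0∞) ∂P.prod ν) atTop
      (𝓝 (∫⁻ q : Ω × ℝ, (f (ξ q.1) : ℝ≥0∞) ∂P.prod ν)) := by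
    refine tendsto_lintegral_of_dominated_convergence' (fun _ => (nndist f 0 : ℝ≥0∞)) hjoint
      (fun t => .of_forall fun q => ?_) (by simp) ?_
    · exact ENNReal.coe_le_coe.2 (BoundedContinuousFunction.NNReal.upper_bound f _)
    · have : ∀ᵐ q ∂P.prod ν, Tendsto (fun t => coreStat (X t q.1)) atTop (𝓝 (ξ q.1, 0)) :=
        Measure.quasiMeasurePreserving_fst.ae hlim
      filter_upwards [this] with q hq
      refine (ENNReal.continuous_coe.tendsto _).comp ((f.continuous.tendsto _).comp ?_)
      simpa using hq.fst_nhds.add (hq.snd_nhds.mul_const q.2)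
  simp only [lintegral_prod _ (hjoint _), hconst] at htend
  have hend := tendsto_nhds_unique htend tendsto_const_nhds
  have hfξ : Measurable fun q : Ω × ℝ => (f (ξ q.1) : ℝ≥0∞) := hf.comp (hξ.comp measurable_fst)
  rw [lintegral_map hf hξ, lintegral_map hf (by fun_prop), lintegral_prod _ hF.aemeasurable,
    lintegral_map' hH.aemeasurable (hX.aemeasurable_coreStat 0), ← hend,
    lintegral_prod _ hfξ.aemeasurable]
  simp

end Limit

/-! ### Moments of the limit -/

section Moments

variable {ρ : Measure (ℝ × ℝ)} [IsProbabilityMeasure ρ] {ν : Measure ℝ} [IsProbabilityMeasure ν]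

/-- As centre and diameter lie in `[0, 1]`, the integrand is dominated by `(1 + |l|) ^ k`. -/
theorem integrable_add_mul_pow (hν : ∀ k : ℕ, Integrable (fun x => |x| ^ k) ν)
    (hρ : ∀ᵐ s ∂ρ, s ∈ Set.Icc (0 : ℝ) 1 ×ˢ Set.Icc (0 : ℝ) 1) (k : ℕ) :
    Integrable (fun q : (ℝ × ℝ) × ℝ => |q.1.1 + q.1.2 * q.2| ^ k) (ρ.prod ν) := by
  have h1 : Integrable (fun x : ℝ => (1 + |x|) ^ k) ν := by
    simp only [add_comm (1 : ℝ), add_pow, one_pow, mul_one]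
    exact integrable_finsetSum _ fun j _ => (hν j).mul_const _
  refine (h1.comp_snd ρ).mono' (by fun_prop) ?_
  have h2 : ∀ᵐ q ∂ρ.prod ν, q.1 ∈ Set.Icc (0 : ℝ) 1 ×ˢ Set.Icc (0 : ℝ) 1 :=
    Measure.quasiMeasurePreserving_fst.ae hρ
  filter_upwards [h2] with q hq
  obtain ⟨⟨h3, h4⟩, h5, h6⟩ := hq
  rw [Real.norm_of_nonneg (by positivity)]
  refine pow_le_pow_left₀ (abs_nonneg _) ((abs_add_le _ _).trans (add_le_add ?_ ?_)) k
  · rwa [abs_of_nonneg h3]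
  · rw [abs_mul, abs_of_nonneg h5]
    exact mul_le_of_le_one_left (abs_nonneg _) h6

theorem integrable_of_continuous {h : ℝ × ℝ → ℝ} (hh : Continuous h)
    (hρ : ∀ᵐ s ∂ρ, s ∈ Set.Icc (0 : ℝ) 1 ×ˢ Set.Icc (0 : ℝ) 1) : Integrable h ρ := by
  obtain ⟨C, hC⟩ := (isCompact_Icc.prod isCompact_Icc).exists_bound_of_continuousOn
    (s := Set.Icc (0 : ℝ) 1 ×ˢ Set.Icc (0 : ℝ) 1) hh.continuousOn
  exact Integrable.of_bound hh.aestronglyMeasurable C (hρ.mono hC)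

theorem integral_map_add_mul_pow (hν : ∀ k : ℕ, Integrable (fun x => |x| ^ k) ν)
    (hρ : ∀ᵐ s ∂ρ, s ∈ Set.Icc (0 : ℝ) 1 ×ˢ Set.Icc (0 : ℝ) 1) (k : ℕ) :
    ∫ x, x ^ k ∂(ρ.prod ν).map (fun q => q.1.1 + q.1.2 * q.2) =
      ∑ j ∈ Finset.range (k + 1),
        k.choose j * (∫ s, s.1 ^ (k - j) * s.2 ^ j ∂ρ) * ∫ l, l ^ j ∂ν := by
  have hint : Integrable (fun q : (ℝ × ℝ) × ℝ => (q.1.1 + q.1.2 * q.2) ^ k) (ρ.prod ν) :=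
    (integrable_add_mul_pow hν hρ k).mono (by fun_prop) (.of_forall fun q => by simp)
  rw [integral_map (by fun_prop) (by fun_prop), integral_prod _ hint]
  simp only [integral_add_mul_pow hν]
  rw [integral_finsetSum _ fun j _ => ?_]
  · refine Finset.sum_congr rfl fun j _ => ?_
    rw [integral_mul_const, integral_const_mul]
  · exact integrable_of_continuous (by fun_prop) hρ

end Moments

/-! ### The law of the initial core -/

section Initial

variable {Ω : Type*} [MeasurableSpace Ω] {P : Measure Ω}
  {α : Measure (Fin 3 → ℝ)} {X : ℕ → Ω → Fin 3 → ℝ}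

theorem IsModifiedProcess.lintegral_initial (hX : IsModifiedProcess P α X)
    {g : (Fin 3 → ℝ) → ℝ≥0∞} (hg : Measurable g) :
    ∫⁻ ω, g (X 0 ω) ∂P = ∫⁻ x, ∫⁻ y, g y ∂orderLaw x ∂α := by
  rw [← lintegral_map' hg.aemeasurable hX.initial.aemeasurable, hX.initial.map_eq,
    Measure.lintegral_bind orderKernel.measurable.aemeasurable hg.aemeasurable]
  rfl

theorem coreStat_mem_of_mem {x : Fin 3 → ℝ} (hx : ∀ i, x i ∈ Set.Icc (0 : ℝ) 1) :
    coreStat x ∈ Set.Icc (0 : ℝ) 1 ×ˢ Set.Icc (0 : ℝ) 1 := by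
  have h1 : coreStat x = ((x 0 + x 1) / 2, |x 0 - x 1|) := by
    simp [coreStat, bary, diam, core]
  obtain ⟨h2, h3⟩ := hx 0
  obtain ⟨h4, h5⟩ := hx 1
  rw [h1]
  refine ⟨⟨by dsimp; linarith, by dsimp; linarith⟩, abs_nonneg _, ?_⟩
  rw [abs_le]
  constructor <;> linarith

theorem IsModifiedProcess.ae_coreStat_mem (hX : IsModifiedProcess P α X)
    (hα : ∀ᵐ x ∂α, ∀ i, x i ∈ Set.Icc (0 : ℝ) 1) :
    ∀ᵐ ω ∂P, coreStat (X 0 ω) ∈ Set.Icc (0 : ℝ) 1 ×ˢ Set.Icc (0 : ℝ) 1 := by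
  have hS : MeasurableSet (Set.Icc (0 : ℝ) 1 ×ˢ Set.Icc (0 : ℝ) 1)ᶜ :=
    (measurableSet_Icc.prod measurableSet_Icc).compl
  have hg : Measurable fun x => (Set.Icc (0 : ℝ) 1 ×ˢ Set.Icc (0 : ℝ) 1)ᶜ.indicator
      (1 : ℝ × ℝ → ℝ≥0∞) (coreStat x) :=
    (measurable_one.indicator hS).comp measurable_coreStat
  have hzero : ∀ᵐ x ∂α, ∫⁻ y, (Set.Icc (0 : ℝ) 1 ×ˢ Set.Icc (0 : ℝ) 1)ᶜ.indicator
      (1 : ℝ × ℝ → ℝ≥0∞) (coreStat y) ∂orderLaw x = 0 := by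
    filter_upwards [hα] with x hx
    refine lintegral_orderLaw fun σ _ => Set.indicator_of_notMem ?_ _
    exact fun hn => hn (coreStat_mem_of_mem fun i => hx (σ i))
  have h := (hX.lintegral_initial hg).trans ((lintegral_congr_ae hzero).trans lintegral_zero)
  have hae := (lintegral_eq_zero_iff' (hg.comp_aemeasurable hX.initial.aemeasurable)).1 h
  filter_upwards [hae] with ω hω
  by_contra hn
  rw [Function.comp_apply, Set.indicator_of_mem (Set.mem_compl hn)] at hω
  exact one_ne_zero hω

/-- The law of the centre and the diameter of the initial core. -/
theorem IsModifiedProcess.lintegral_map_coreStat (hX : IsModifiedProcess P α X)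
    {g : ℝ × ℝ → ℝ≥0∞} (hg : Measurable g) :
    ∫⁻ s, g s ∂P.map (fun ω => coreStat (X 0 ω)) =
      ∫⁻ x, ∫⁻ y, g (coreStat y) ∂orderLaw x ∂α := by
  refine (lintegral_map' hg.aemeasurable
    (measurable_coreStat.comp_aemeasurable hX.initial.aemeasurable)).trans ?_
  exact hX.lintegral_initial (hg.comp measurable_coreStat)

/-- The middle point is the barycentre and the outer two are tied, so exactly the two orderings that
start with the middle point are admissible. -/
theorem sortings_quarters :
    sortings ![1 / 4, 1 / 2, 3 / 4] = {Equiv.swap 0 1, finRotate 3} := by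
  have hb : bary ![1 / 4, 1 / 2, 3 / 4] = 1 / 2 := by
    simp [bary, Fin.sum_univ_three]; norm_num
  have h1 : ∀ σ : Equiv.Perm (Fin 3), σ ∈ sortings ![1 / 4, 1 / 2, 3 / 4] ↔ σ 0 = 1 := by
    intro σ
    rw [mem_sortings, hb]
    have hval : ∀ i : Fin 3, |(![1 / 4, 1 / 2, 3 / 4] : Fin 3 → ℝ) i - 1 / 2| =
        if i = 1 then 0 else 1 / 4 := fun i => by
      fin_cases i <;> simp <;> norm_num [abs_of_neg, abs_of_pos]
    simp only [hval]
    constructor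
    · intro h
      by_contra hne
      have h2 := h (Fin.zero_le (σ.symm 1))
      simp only [Equiv.apply_symm_apply, if_neg hne, if_true] at h2
      norm_num at h2
    · intro h0 i j hij
      have hj : σ j = 1 → i = 0 ∧ j = 0 := fun hj => by
        have hj0 : j = 0 := σ.injective (hj.trans h0.symm)
        exact ⟨Fin.le_zero_iff.1 (hj0 ▸ hij), hj0⟩
      by_cases hj1 : σ j = 1
      · obtain ⟨rfl, rfl⟩ := hj hj1
        exact le_rfl
      · simp only [if_neg hj1]
        split_ifs <;> norm_num
  have h2 : ∀ σ : Equiv.Perm (Fin 3), σ 0 = 1 ↔ σ = Equiv.swap 0 1 ∨ σ = finRotate 3 := by decide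
  ext σ
  rw [h1, h2, Finset.mem_insert, Finset.mem_singleton]

theorem IsModifiedProcess.map_coreStat_of_dirac
    (hX : IsModifiedProcess P (Measure.dirac ![1 / 4, 1 / 2, 3 / 4]) X) :
    P.map (fun ω => coreStat (X 0 ω)) =
      (2⁻¹ : ℝ≥0∞) • (Measure.dirac (3 / 8, 1 / 4) + Measure.dirac (5 / 8, 1 / 4)) := by
  refine Measure.ext_of_lintegral _ fun g hg => ?_
  have hne : (Equiv.swap 0 1 : Equiv.Perm (Fin 3)) ≠ finRotate 3 := by decide
  have hm : Measurable fun x => ∫⁻ y, g (coreStat y) ∂orderLaw x :=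
    (Measure.measurable_lintegral (hg.comp measurable_coreStat)).comp measurable_orderLaw
  have e1 : restStat ![1 / 4, 1 / 2, 3 / 4] ((Equiv.swap 0 1 : Equiv.Perm (Fin 3)) 2) =
      (3 / 8, 1 / 4) := by
    rw [show (Equiv.swap 0 1 : Equiv.Perm (Fin 3)) 2 = 2 by decide]
    simp [restStat, Fin.succAbove]
    constructor <;> norm_num [abs_of_neg]
  have e2 : restStat ![1 / 4, 1 / 2, 3 / 4] ((finRotate 3 : Equiv.Perm (Fin 3)) 2) =
      (5 / 8, 1 / 4) := by
    rw [show (finRotate 3 : Equiv.Perm (Fin 3)) 2 = 0 by decide]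
    simp [restStat, Fin.succAbove]
    constructor <;> norm_num [abs_of_neg]
  rw [hX.lintegral_map_coreStat hg, lintegral_dirac' _ hm, orderLaw, sortings_quarters,
    Finset.sum_pair hne, Finset.card_pair hne]
  simp only [lintegral_add_measure, lintegral_smul_measure, smul_eq_mul, lintegral_dirac,
    coreStat_comp_perm, e1, e2, lintegral_dirac' _ hg]
  rw [mul_add]
  norm_num

theorem IsModifiedProcess.integral_coreStat_of_dirac
    (hX : IsModifiedProcess P (Measure.dirac ![1 / 4, 1 / 2, 3 / 4]) X) (h : ℝ × ℝ → ℝ) :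
    ∫ s, h s ∂P.map (fun ω => coreStat (X 0 ω)) = (h (3 / 8, 1 / 4) + h (5 / 8, 1 / 4)) / 2 := by
  rw [hX.map_coreStat_of_dirac, integral_smul_measure, integral_add_measure
    (integrable_dirac (by simp)) (integrable_dirac (by simp)), integral_dirac, integral_dirac]
  simp
  ring

end Initial

/-! ### Three independent uniform initial points -/

section Uniform

/-- The points `x` such that `x i` is strictly the farthest from the barycentre. -/
def extremeSet (i : Fin 3) : Set (Fin 3 → ℝ) :=
  {x | 3 / 2 * |x (i.succAbove 0) - x (i.succAbove 1)| <
    |x i - (x (i.succAbove 0) + x (i.succAbove 1)) / 2|}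

theorem bary_eq_succAbove (x : Fin 3 → ℝ) (i : Fin 3) :
    bary x = (x i + x (i.succAbove 0) + x (i.succAbove 1)) / 3 := by
  rw [bary, Fin.sum_univ_succAbove _ i]
  simp [Fin.sum_univ_two, add_assoc]

/-- With `c = x i` and the other points `a`, `b` of midpoint `m`, the distance of `c` to the
barycentre is `2/3 * |c - m|`, while the larger of the other two distances is `|a - b| / 2 + |c - m|
/ 3`. -/
theorem mem_extremeSet {x : Fin 3 → ℝ} {i : Fin 3} :
    x ∈ extremeSet i ↔ ∀ j, j ≠ i → |x j - bary x| < |x i - bary x| := by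
  have hall : (∀ j, j ≠ i → |x j - bary x| < |x i - bary x|) ↔
      |x (i.succAbove 0) - bary x| < |x i - bary x| ∧
      |x (i.succAbove 1) - bary x| < |x i - bary x| := by
    rw [Fin.forall_iff_succAbove i]
    simp [Fin.succAbove_ne, Fin.forall_fin_two]
  rw [hall, bary_eq_succAbove x i]
  simp only [extremeSet, Set.mem_ofPred_eq]
  generalize x (i.succAbove 0) = a
  generalize x (i.succAbove 1) = b
  generalize x i = c
  constructor
  · intro h
    constructor <;> cases abs_cases (a - b) <;> cases abs_cases (c - (a + b) / 2) <;>
      cases abs_cases (c - (c + a + b) / 3) <;> rw [abs_lt] <;> constructor <;> linarith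
  · rintro ⟨h1, h2⟩
    cases abs_cases (a - b) <;> cases abs_cases (c - (a + b) / 2) <;>
      cases abs_cases (c - (c + a + b) / 3) <;> rw [abs_lt] at h1 h2 <;> linarith

theorem disjoint_extremeSet {i j : Fin 3} (hij : i ≠ j) {x : Fin 3 → ℝ} (hi : x ∈ extremeSet i) :
    x ∉ extremeSet j := fun hj =>
  lt_asymm (mem_extremeSet.1 hi j hij.symm) (mem_extremeSet.1 hj i hij)

theorem ae_pi_uniform01_ne_zero (φ : (Fin 3 → ℝ) →ₗ[ℝ] ℝ) (hφ : φ ≠ 0) :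
    ∀ᵐ x ∂Measure.pi (fun _ : Fin 3 => uniform01), φ x ≠ 0 := by
  have h1 : (volume : Measure (Fin 3 → ℝ)) (LinearMap.ker φ : Set (Fin 3 → ℝ)) = 0 :=
    Measure.addHaar_submodule _ _ fun h => hφ (LinearMap.ker_eq_top.1 h)
  have h2 : Measure.pi (fun _ : Fin 3 => uniform01) ≪ volume := by
    unfold uniform01
    rw [← Measure.restrict_pi_pi]
    exact Measure.absolutelyContinuous_of_le Measure.restrict_le_self
  rw [ae_iff]
  refine h2 (le_antisymm ((measure_mono fun x hx => ?_).trans_eq h1) zero_le)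
  simpa using hx

/-- A tie for the farthest point forces two points to coincide or one to be the midpoint of the
others; each case is the kernel of a nonzero linear form, hence null. -/
theorem ae_exists_mem_extremeSet :
    ∀ᵐ x ∂Measure.pi (fun _ : Fin 3 => uniform01), ∃ i, x ∈ extremeSet i := by
  have h1 : ∀ i j k : Fin 3, i ≠ k → ∀ᵐ x ∂Measure.pi (fun _ : Fin 3 => uniform01),
      x i + x j - 2 * x k ≠ 0 := by
    intro i j k hik
    refine ae_pi_uniform01_ne_zero (LinearMap.proj (R := ℝ) (φ := fun _ : Fin 3 => ℝ) i +
      LinearMap.proj j - (2 : ℝ) • LinearMap.proj k) fun h => ?_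
    have h2 := LinearMap.congr_fun h (Pi.single k 1)
    rcases eq_or_ne j k with hjk | hjk <;> norm_num [hik, hjk] at h2
  have h2 : ∀ i k : Fin 3, i ≠ k → ∀ᵐ x ∂Measure.pi (fun _ : Fin 3 => uniform01), x i ≠ x k := by
    intro i k hik
    filter_upwards [h1 i i k hik] with x hx h
    exact hx (by rw [h]; ring)
  filter_upwards [h1 0 1 2 (by decide), h1 0 2 1 (by decide), h1 1 2 0 (by decide),
    h2 0 1 (by decide), h2 0 2 (by decide), h2 1 2 (by decide)] with x a1 a2 a3 a4 a5 a6
  obtain ⟨i, hi⟩ := Finite.exists_max fun i => |x i - bary x|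
  refine ⟨i, mem_extremeSet.2 fun j hj => lt_of_le_of_ne (hi j) fun heq => ?_⟩
  have hb : bary x = (x 0 + x 1 + x 2) / 3 := by
    simp [bary, Fin.sum_univ_three]
  rw [hb] at heq
  rcases abs_eq_abs.1 heq with h | h
  all_goals
    fin_cases i <;> fin_cases j <;> simp at hj h <;>
    first
    | exact a4 (by linarith) | exact a5 (by linarith) | exact a6 (by linarith)
    | exact a1 (by linarith) | exact a2 (by linarith) | exact a3 (by linarith)

variable {Ω : Type*} [MeasurableSpace Ω] {P : Measure Ω} {X : ℕ → Ω → Fin 3 → ℝ}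

/-- The region of the pairs of core and third point such that the third point is the extreme
one. -/
def extremeRegion : Set (ℝ × ℝ × ℝ) :=
  {p | 3 / 2 * |p.2.1 - p.2.2| < |p.1 - (p.2.1 + p.2.2) / 2|}

theorem measurableSet_extremeRegion : MeasurableSet extremeRegion := by
  unfold extremeRegion; measurability

theorem measurePreserving_splitPoint (i : Fin 3) :
    MeasurePreserving (fun x : Fin 3 → ℝ => (x i, x (i.succAbove 0), x (i.succAbove 1)))
      (Measure.pi fun _ => uniform01) (uniform01.prod (uniform01.prod uniform01)) :=
  ((MeasurePreserving.id uniform01).prod (measurePreserving_finTwoArrow uniform01)).comp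
    (measurePreserving_piFinSuccAbove (fun _ => uniform01) i)

/-- By exchangeability each of the three points is equally likely to be the extreme one, whence the
factor `3`. -/
theorem IsModifiedProcess.map_coreStat_of_uniform
    (hX : IsModifiedProcess P (Measure.pi fun _ => uniform01) X) :
    P.map (fun ω => coreStat (X 0 ω)) =
      (3 : ℝ≥0∞) • ((uniform01.prod (uniform01.prod uniform01)).restrict extremeRegion).map
        fun p => ((p.2.1 + p.2.2) / 2, |p.2.1 - p.2.2|) := by
  refine Measure.ext_of_lintegral _ fun g hg => ?_
  have hK : Measurable (extremeRegion.indicator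
      fun p : ℝ × ℝ × ℝ => g ((p.2.1 + p.2.2) / 2, |p.2.1 - p.2.2|)) :=
    (hg.comp (by fun_prop)).indicator measurableSet_extremeRegion
  have hcomp : ∀ i : Fin 3, Measurable fun x : Fin 3 → ℝ => extremeRegion.indicator
      (fun p : ℝ × ℝ × ℝ => g ((p.2.1 + p.2.2) / 2, |p.2.1 - p.2.2|))
      (x i, x (i.succAbove 0), x (i.succAbove 1)) := fun i =>
    hK.comp (measurePreserving_splitPoint i).measurable
  have hint := fun i : Fin 3 => (measurePreserving_splitPoint i).lintegral_comp hK
  have hsum : ∀ᵐ x ∂Measure.pi (fun _ : Fin 3 => uniform01),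
      ∫⁻ y, g (coreStat y) ∂orderLaw x = ∑ i, extremeRegion.indicator
        (fun p : ℝ × ℝ × ℝ => g ((p.2.1 + p.2.2) / 2, |p.2.1 - p.2.2|))
        (x i, x (i.succAbove 0), x (i.succAbove 1)) := by
    filter_upwards [ae_exists_mem_extremeSet] with x ⟨i, hi⟩
    rw [lintegral_coreStat_orderLaw g (mem_extremeSet.1 hi), Finset.sum_eq_single i]
    · rw [Set.indicator_of_mem]
      · rfl
      · exact hi
    · intro j _ hj
      rw [Set.indicator_of_notMem]
      exact disjoint_extremeSet (Ne.symm hj) hi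
    · simp
  rw [hX.lintegral_map_coreStat hg, lintegral_congr_ae hsum, lintegral_finsetSum _ fun i _ => hcomp i,
    Finset.sum_congr rfl fun i _ => hint i, Finset.sum_const, lintegral_smul_measure, lintegral_map hg (by fun_prop),
    ← lintegral_indicator measurableSet_extremeRegion]
  simp

/-- The measure of the points of `[0, 1]` to the left of the core `{a, b}` that are extreme. -/
def leftMass (a b : ℝ) : ℝ := max ((a + b) / 2 - 3 / 2 * |a - b|) 0

theorem continuous_leftMass : Continuous fun p : ℝ × ℝ => leftMass p.1 p.2 := by
  unfold leftMass; fun_prop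

/-- The extreme positions form one interval at each end of `[0, 1]`; the right one is the mirror
image of the left one for the reflected core. -/
theorem measureReal_extremeRegion {a b : ℝ} (ha : a ∈ Set.Icc (0 : ℝ) 1)
    (hb : b ∈ Set.Icc (0 : ℝ) 1) :
    uniform01.real {c | (c, a, b) ∈ extremeRegion} = leftMass a b + leftMass (1 - a) (1 - b) := by
  obtain ⟨a0, a1⟩ := ha
  obtain ⟨b0, b1⟩ := hb
  have hab : 0 ≤ |a - b| := abs_nonneg _
  have hle : (a + b) / 2 - 3 / 2 * |a - b| ≤ 1 := by linarith
  have hge : 0 ≤ (a + b) / 2 + 3 / 2 * |a - b| := by linarith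
  have hset : {c | (c, a, b) ∈ extremeRegion} ∩ Set.Icc 0 1 =
      Set.Ico 0 ((a + b) / 2 - 3 / 2 * |a - b|) ∪ Set.Ioc ((a + b) / 2 + 3 / 2 * |a - b|) 1 := by
    ext c
    simp only [extremeRegion, Set.mem_inter_iff, Set.mem_ofPred_eq, Set.mem_Icc, Set.mem_union,
      Set.mem_Ico, Set.mem_Ioc, lt_abs]
    constructor
    · rintro ⟨h | h, h0, h1⟩
      · exact Or.inr ⟨by linarith, h1⟩
      · exact Or.inl ⟨h0, by linarith⟩
    · rintro (⟨h0, h⟩ | ⟨h, h1⟩)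
      · exact ⟨Or.inr (by linarith), h0, by linarith⟩
      · exact ⟨Or.inl (by linarith), by linarith, h1⟩
  have hdisj : Disjoint (Set.Ico 0 ((a + b) / 2 - 3 / 2 * |a - b|))
      (Set.Ioc ((a + b) / 2 + 3 / 2 * |a - b|) 1) :=
    Set.disjoint_left.2 fun c h1 h2 => by
      have := h1.2
      have := h2.1
      linarith
  rw [uniform01, measureReal_restrict_apply' measurableSet_Icc, hset,
    measureReal_union hdisj measurableSet_Ioc (by simp) (by simp), Real.volume_real_Ico,
    Real.volume_real_Ioc, leftMass, leftMass, show 1 - a - (1 - b) = -(a - b) by ring, abs_neg]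
  congr 2 <;> ring

theorem ae_prod_uniform01_mem : ∀ᵐ p ∂uniform01.prod uniform01,
    p.1 ∈ Set.Icc (0 : ℝ) 1 ∧ p.2 ∈ Set.Icc (0 : ℝ) 1 :=
  (Measure.quasiMeasurePreserving_fst.ae ae_uniform01_mem).and
    (Measure.quasiMeasurePreserving_snd.ae ae_uniform01_mem)

theorem integral_prod_uniform01 {f : ℝ × ℝ → ℝ} (hf : Continuous f) :
    ∫ p, f p ∂uniform01.prod uniform01 = ∫ a in (0 : ℝ)..1, ∫ b in (0 : ℝ)..1, f (a, b) := by
  obtain ⟨C, hC⟩ := (isCompact_Icc.prod isCompact_Icc).exists_bound_of_continuousOn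
    (s := Set.Icc (0 : ℝ) 1 ×ˢ Set.Icc (0 : ℝ) 1) hf.continuousOn
  rw [integral_prod _ (Integrable.of_bound hf.aestronglyMeasurable C
    (ae_prod_uniform01_mem.mono fun p hp => hC p ⟨hp.1, hp.2⟩)), integral_uniform01]
  simp only [integral_uniform01]

theorem IsModifiedProcess.integral_coreStat_of_uniform
    (hX : IsModifiedProcess P (Measure.pi fun _ => uniform01) X) {h : ℝ × ℝ → ℝ}
    (hh : Continuous h) :
    ∫ s, h s ∂P.map (fun ω => coreStat (X 0 ω)) =
      3 * ∫ a in (0 : ℝ)..1, ∫ b in (0 : ℝ)..1,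
        (leftMass a b + leftMass (1 - a) (1 - b)) * h ((a + b) / 2, |a - b|) := by
  have hφ : Continuous fun p : ℝ × ℝ × ℝ => h ((p.2.1 + p.2.2) / 2, |p.2.1 - p.2.2|) := by fun_prop
  obtain ⟨C, hC⟩ := (isCompact_Icc.prod (isCompact_Icc.prod isCompact_Icc)).exists_bound_of_continuousOn
    (s := Set.Icc (0 : ℝ) 1 ×ˢ Set.Icc (0 : ℝ) 1 ×ˢ Set.Icc (0 : ℝ) 1) hφ.continuousOn
  have hmem : ∀ᵐ p ∂uniform01.prod (uniform01.prod uniform01),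
      p ∈ Set.Icc (0 : ℝ) 1 ×ˢ Set.Icc (0 : ℝ) 1 ×ˢ Set.Icc (0 : ℝ) 1 :=
    (Measure.quasiMeasurePreserving_fst.ae ae_uniform01_mem).and
      (Measure.quasiMeasurePreserving_snd.ae ae_prod_uniform01_mem)
  have hint : Integrable (fun p : ℝ × ℝ × ℝ => h ((p.2.1 + p.2.2) / 2, |p.2.1 - p.2.2|))
      (uniform01.prod (uniform01.prod uniform01)) :=
    Integrable.of_bound hφ.aestronglyMeasurable C (hmem.mono hC)
  rw [hX.map_coreStat_of_uniform, integral_smul_measure,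
    integral_map (by fun_prop) hh.aestronglyMeasurable,
    ← integral_indicator measurableSet_extremeRegion,
    integral_prod_symm _ (hint.indicator measurableSet_extremeRegion)]
  have hl := continuous_leftMass
  have hl' : Continuous fun p : ℝ × ℝ => leftMass (1 - p.1) (1 - p.2) :=
    hl.comp (g := fun p : ℝ × ℝ => leftMass p.1 p.2) (f := fun p : ℝ × ℝ => (1 - p.1, 1 - p.2))
      (by fun_prop)
  rw [← integral_prod_uniform01 (f := fun p => (leftMass p.1 p.2 + leftMass (1 - p.1) (1 - p.2)) *
    h ((p.1 + p.2) / 2, |p.1 - p.2|)) (by fun_prop), smul_eq_mul]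
  congr 1
  refine integral_congr_ae ?_
  filter_upwards [ae_prod_uniform01_mem] with p hp
  rw [← measureReal_extremeRegion hp.1 hp.2]
  have hm : MeasurableSet {c | (c, p) ∈ extremeRegion} :=
    measurable_prodMk_right measurableSet_extremeRegion
  have hind : (fun c => extremeRegion.indicator
      (fun p : ℝ × ℝ × ℝ => h ((p.2.1 + p.2.2) / 2, |p.2.1 - p.2.2|)) (c, p)) =
      {c | (c, p) ∈ extremeRegion}.indicator fun _ => h ((p.1 + p.2) / 2, |p.1 - p.2|) := rfl
  rw [hind, integral_indicator_const _ hm, smul_eq_mul]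

end Uniform

/-! ### The moments of the initial core, for three independent uniform points -/

section UniformMoments

theorem leftMass_of_le {a b : ℝ} (h : b ≤ a) : leftMass a b = max (2 * b - a) 0 := by
  rw [leftMass, abs_of_nonneg (by linarith)]
  congr 1; ring

theorem leftMass_of_ge {a b : ℝ} (h : a ≤ b) : leftMass a b = max (2 * a - b) 0 := by
  rw [leftMass, abs_of_nonpos (by linarith)]
  congr 1; ring

theorem integral_leftMass_mul_zero_left {a : ℝ} (ha : 0 ≤ a) {T : ℝ → ℝ} (hT : Continuous T) :
    ∫ b in (0 : ℝ)..a, leftMass a b * T b = ∫ b in (a / 2)..a, (2 * b - a) * T b := by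
  have hc : Continuous fun b => leftMass a b * T b := by unfold leftMass; fun_prop
  rw [← intervalIntegral.integral_add_adjacent_intervals (hc.intervalIntegrable 0 (a / 2))
    (hc.intervalIntegrable (a / 2) a), intervalIntegral.integral_congr (g := fun _ => 0),
    intervalIntegral.integral_zero, zero_add]
  · refine intervalIntegral.integral_congr fun b hb => ?_
    rw [Set.uIcc_of_le (by linarith)] at hb
    rw [leftMass_of_le hb.2, max_eq_left (by linarith [hb.1])]
  · intro b hb
    rw [Set.uIcc_of_le (by linarith)] at hb
    dsimp only
    rw [leftMass_of_le (by linarith [hb.2]), max_eq_right (by linarith [hb.2]), zero_mul]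

theorem integral_leftMass_mul_of_le {a c : ℝ} (hac : a ≤ c) (hc : c ≤ 2 * a) (T : ℝ → ℝ) :
    ∫ b in a..c, leftMass a b * T b = ∫ b in a..c, (2 * a - b) * T b := by
  refine intervalIntegral.integral_congr fun b hb => ?_
  rw [Set.uIcc_of_le hac] at hb
  rw [leftMass_of_ge hb.1, max_eq_left (by linarith [hb.2])]

theorem integral_leftMass_mul_eq_zero {a c d : ℝ} (hcd : c ≤ d) (ha : 0 ≤ a) (hc : 2 * a ≤ c)
    (T : ℝ → ℝ) : ∫ b in c..d, leftMass a b * T b = 0 := by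
  rw [intervalIntegral.integral_congr (g := fun _ => 0), intervalIntegral.integral_zero]
  intro b hb
  rw [Set.uIcc_of_le hcd] at hb
  dsimp only
  rw [leftMass_of_ge (by linarith [hb.1]), max_eq_right (by linarith [hb.1]), zero_mul]

/-- `leftMass a b` is the positive part of `2 * min a b - max a b`, supported on `a / 2 ≤ b ≤ 2 *
a`. On each side of `b = a` the integrand is polynomial, and the outer integral splits at `a = 1/2`,
where `2 * a` reaches the endpoint `1`. -/
theorem integral_leftMass_mul (p q r s : ℝ) :
    ∫ a in (0 : ℝ)..1, ∫ b in (0 : ℝ)..1,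
      leftMass a b * (p + q * ((a + b) / 2) + r * ((a + b) / 2) ^ 2 + s * |a - b| ^ 2) =
      p / 6 + 11 / 96 * q + 27 / 320 * r + s / 240 := by
  have hl := continuous_leftMass
  have hcont : Continuous (Function.uncurry fun a b : ℝ =>
      leftMass a b * (p + q * ((a + b) / 2) + r * ((a + b) / 2) ^ 2 + s * |a - b| ^ 2)) := by
    unfold Function.uncurry; fun_prop
  have hout := intervalIntegral.continuous_parametric_intervalIntegral_of_continuous'
    (μ := volume) hcont 0 1
  have hb : ∀ a : ℝ, Continuous fun b : ℝ =>
      leftMass a b * (p + q * ((a + b) / 2) + r * ((a + b) / 2) ^ 2 + s * |a - b| ^ 2) :=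
    fun a => hcont.comp (Continuous.prodMk_right a)
  -- The coefficients come from writing the test polynomial as a quadratic in `b`, with `a` as a
  -- parameter, and multiplying by the linear factor.
  have h1 : ∀ a : ℝ, ∫ b in (a / 2)..a, (2 * b - a) *
      (p + q * ((a + b) / 2) + r * ((a + b) / 2) ^ 2 + s * |a - b| ^ 2) = _ := fun a =>
    integral_of_eq_poly (a / 2) a
      (-a * (p + q * a / 2 + r * a ^ 2 / 4 + s * a ^ 2))
      (2 * (p + q * a / 2 + r * a ^ 2 / 4 + s * a ^ 2) - a * (q / 2 + r * a / 2 - 2 * s * a))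
      (2 * (q / 2 + r * a / 2 - 2 * s * a) - a * (r / 4 + s)) (2 * (r / 4 + s)) 0 0 0
      (fun b => by rw [sq_abs]; ring)
  have h2 : ∀ a c : ℝ, ∫ b in a..c, (2 * a - b) *
      (p + q * ((a + b) / 2) + r * ((a + b) / 2) ^ 2 + s * |a - b| ^ 2) = _ := fun a c =>
    integral_of_eq_poly a c
      (2 * a * (p + q * a / 2 + r * a ^ 2 / 4 + s * a ^ 2))
      (2 * a * (q / 2 + r * a / 2 - 2 * s * a) - (p + q * a / 2 + r * a ^ 2 / 4 + s * a ^ 2))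
      (2 * a * (r / 4 + s) - (q / 2 + r * a / 2 - 2 * s * a)) (-(r / 4 + s)) 0 0 0
      (fun b => by rw [sq_abs]; ring)
  have hlow : ∫ a in (0 : ℝ)..(1 / 2), ∫ b in (0 : ℝ)..1,
      leftMass a b * (p + q * ((a + b) / 2) + r * ((a + b) / 2) ^ 2 + s * |a - b| ^ 2) =
      1 / 32 * p + 13 / 1024 * q + 23 / 4096 * r + 3 / 5120 * s := by
    refine (intervalIntegral.integral_congr (g := fun a =>
      (∫ b in (a / 2)..a, (2 * b - a) *
        (p + q * ((a + b) / 2) + r * ((a + b) / 2) ^ 2 + s * |a - b| ^ 2)) +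
      ∫ b in a..(2 * a), (2 * a - b) *
        (p + q * ((a + b) / 2) + r * ((a + b) / 2) ^ 2 + s * |a - b| ^ 2)) fun a ha => ?_).trans
      ((integral_of_eq_poly 0 (1 / 2)
        0 0 (3 / 4 * p) (13 / 16 * q) (115 / 128 * r + 3 / 32 * s) 0 0
        fun a => by simp only [h1, h2]; ring).trans (by ring))
    rw [Set.uIcc_of_le (by norm_num)] at ha
    dsimp only
    rw [← intervalIntegral.integral_add_adjacent_intervals ((hb a).intervalIntegrable 0 a)
      ((hb a).intervalIntegrable a 1), ← intervalIntegral.integral_add_adjacent_intervals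
      ((hb a).intervalIntegrable a (2 * a)) ((hb a).intervalIntegrable (2 * a) 1),
      integral_leftMass_mul_zero_left ha.1 (by fun_prop),
      integral_leftMass_mul_of_le (by linarith [ha.1]) le_rfl,
      integral_leftMass_mul_eq_zero (by linarith [ha.2]) ha.1 le_rfl, add_zero]
  have hhigh : ∫ a in (1 / 2 : ℝ)..1, ∫ b in (0 : ℝ)..1,
      leftMass a b * (p + q * ((a + b) / 2) + r * ((a + b) / 2) ^ 2 + s * |a - b| ^ 2) =
      13 / 96 * p + 313 / 3072 * q + 1613 / 20480 * r + 11 / 3072 * s := by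
    refine (intervalIntegral.integral_congr (g := fun a =>
      (∫ b in (a / 2)..a, (2 * b - a) *
        (p + q * ((a + b) / 2) + r * ((a + b) / 2) ^ 2 + s * |a - b| ^ 2)) +
      ∫ b in a..1, (2 * a - b) *
        (p + q * ((a + b) / 2) + r * ((a + b) / 2) ^ 2 + s * |a - b| ^ 2)) fun a ha => ?_).trans
      ((integral_of_eq_poly (1 / 2) 1
        (-1 / 2 * p - 1 / 6 * q - 1 / 16 * r - 1 / 4 * s) (2 * p + 1 / 4 * q + 4 / 3 * s) (-5 / 4 * p + 1 * q + 3 / 8 * r - 5 / 2 * s) (-41 / 48 * q + 1 / 2 * r + 2 * s) (-77 / 128 * r - 55 / 96 * s) 0 0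
        fun a => by simp only [h1, h2]; ring).trans (by ring))
    rw [Set.uIcc_of_le (by norm_num)] at ha
    dsimp only
    rw [← intervalIntegral.integral_add_adjacent_intervals ((hb a).intervalIntegrable 0 a)
      ((hb a).intervalIntegrable a 1), integral_leftMass_mul_zero_left (by linarith [ha.1]) (by fun_prop),
      integral_leftMass_mul_of_le ha.2 (by linarith [ha.1])]
  rw [← intervalIntegral.integral_add_adjacent_intervals (hout.intervalIntegrable 0 (1 / 2))
    (hout.intervalIntegrable (1 / 2) 1), hlow, hhigh]
  ring

variable {Ω : Type*} [MeasurableSpace Ω] {P : Measure Ω} {X : ℕ → Ω → Fin 3 → ℝ}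

/-- The substitution `(a, b) ↦ (1 - a, 1 - b)` moves the right-hand extreme points to the left, at
the cost of symmetrising `h` in the centre. -/
theorem integral_leftMass_reflect {h : ℝ × ℝ → ℝ} (hh : Continuous h) :
    ∫ a in (0 : ℝ)..1, ∫ b in (0 : ℝ)..1,
      (leftMass a b + leftMass (1 - a) (1 - b)) * h ((a + b) / 2, |a - b|) =
      ∫ a in (0 : ℝ)..1, ∫ b in (0 : ℝ)..1,
        leftMass a b * (h ((a + b) / 2, |a - b|) + h (1 - (a + b) / 2, |a - b|)) := by
  have hl := continuous_leftMass
  have key : ∀ {f g : ℝ → ℝ → ℝ}, Continuous (Function.uncurry f) → Continuous (Function.uncurry g) →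
      ∫ a in (0 : ℝ)..1, ∫ b in (0 : ℝ)..1, (f a b + g a b) =
      (∫ a in (0 : ℝ)..1, ∫ b in (0 : ℝ)..1, f a b) +
        ∫ a in (0 : ℝ)..1, ∫ b in (0 : ℝ)..1, g a b := by
    intro f g hf hg
    rw [← intervalIntegral.integral_add
      ((intervalIntegral.continuous_parametric_intervalIntegral_of_continuous'
        (μ := volume) hf 0 1).intervalIntegrable 0 1)
      ((intervalIntegral.continuous_parametric_intervalIntegral_of_continuous'
        (μ := volume) hg 0 1).intervalIntegrable 0 1)]
    refine intervalIntegral.integral_congr fun a _ => ?_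
    exact intervalIntegral.integral_add
      ((hf.comp (Continuous.prodMk_right a)).intervalIntegrable 0 1)
      ((hg.comp (Continuous.prodMk_right a)).intervalIntegrable 0 1)
  have hl' : Continuous fun p : ℝ × ℝ => leftMass (1 - p.1) (1 - p.2) :=
    hl.comp (g := fun p : ℝ × ℝ => leftMass p.1 p.2) (f := fun p : ℝ × ℝ => (1 - p.1, 1 - p.2))
      (by fun_prop)
  have c1 : Continuous (Function.uncurry fun a b : ℝ => leftMass a b * h ((a + b) / 2, |a - b|)) := by
    unfold Function.uncurry; fun_prop
  have c2 : Continuous (Function.uncurry fun a b : ℝ =>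
      leftMass (1 - a) (1 - b) * h ((a + b) / 2, |a - b|)) := by
    unfold Function.uncurry; fun_prop
  have c3 : Continuous (Function.uncurry fun a b : ℝ =>
      leftMass a b * h (1 - (a + b) / 2, |a - b|)) := by
    unfold Function.uncurry; fun_prop
  simp only [add_mul, mul_add]
  rw [key c1 c2, key c1 c3]
  congr 1
  have r1 := intervalIntegral.integral_comp_sub_left (a := 0) (b := 1) (fun a : ℝ =>
    ∫ b in (0 : ℝ)..1, leftMass a b * h (1 - (a + b) / 2, |a - b|)) 1
  simp only [sub_self, sub_zero] at r1
  rw [← r1]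
  refine intervalIntegral.integral_congr fun a _ => ?_
  have r2 := intervalIntegral.integral_comp_sub_left (a := 0) (b := 1) (fun b : ℝ =>
    leftMass (1 - a) b * h (1 - ((1 - a) + b) / 2, |(1 - a) - b|)) 1
  simp only [sub_self, sub_zero] at r2
  rw [← r2]
  refine intervalIntegral.integral_congr fun b _ => ?_
  rw [show 1 - (1 - a + (1 - b)) / 2 = (a + b) / 2 by ring,
    show 1 - a - (1 - b) = -(a - b) by ring, abs_neg]

theorem IsModifiedProcess.integral_coreStat_of_uniform_of_eq
    (hX : IsModifiedProcess P (Measure.pi fun _ => uniform01) X) {h : ℝ × ℝ → ℝ}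
    (hh : Continuous h) (p q r s : ℝ)
    (hsymm : ∀ m d, h (m, d) + h (1 - m, d) = p + q * m + r * m ^ 2 + s * d ^ 2) :
    ∫ s, h s ∂P.map (fun ω => coreStat (X 0 ω)) =
      3 * (p / 6 + 11 / 96 * q + 27 / 320 * r + s / 240) := by
  rw [hX.integral_coreStat_of_uniform hh, integral_leftMass_reflect hh]
  simp only [hsymm]
  rw [integral_leftMass_mul]

end UniformMoments

end BeautyContest

end

/-! ### Assembly: the law of `L`, the limit and its moments, the two examples -/

theorem mainTheorem4 :
    ∃ ν : Measure ℝ, IsProbabilityMeasure ν ∧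
      -- the law of `L` is the unique solution of the fixed-point equation
      ν = BeautyContest.fixMap ν ∧
      (∀ ν' : Measure ℝ, IsProbabilityMeasure ν' → ν' = BeautyContest.fixMap ν' → ν' = ν) ∧
      -- it is symmetric and has all moments
      ν.map (fun x => -x) = ν ∧
      (∀ k : ℕ, Integrable (fun x => |x| ^ k) ν) ∧
      (∀ k : ℕ, Odd k → (∫ x, x ^ k ∂ν) = 0) ∧
      (∫ x, x ^ 2 ∂ν) = 7 / 12 ∧
      (∫ x, x ^ 4 ∂ν) = 375 / 368 ∧
      (∫ x, x ^ 6 ∂ν) = 76693 / 22080 ∧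
      -- the limit of the core, for every initial law of three distinct points of `[0, 1]`
      ∀ {Ω : Type*} [MeasurableSpace Ω] (P : Measure Ω) [IsProbabilityMeasure P]
        (α : Measure (Fin 3 → ℝ)) [IsProbabilityMeasure α] (X : ℕ → Ω → Fin 3 → ℝ),
        (∀ᵐ x ∂α, Function.Injective x ∧ ∀ i, x i ∈ Set.Icc (0 : ℝ) 1) →
        BeautyContest.IsModifiedProcess P α X →
        ∀ μ D : Ω → ℝ,
        (μ = fun ω => BeautyContest.bary (BeautyContest.core (X 0 ω))) →
        (D = fun ω => BeautyContest.diam (BeautyContest.core (X 0 ω))) →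
        ∃ ξ : Ω → ℝ, Measurable ξ ∧
          (∀ᵐ ω ∂P, Tendsto (fun t => BeautyContest.core (X t ω)) atTop (𝓝 fun _ => ξ ω)) ∧
          P.map ξ =
            ((P.map fun ω => (μ ω, D ω)).prod ν).map (fun q => q.1.1 + q.1.2 * q.2) ∧
          (∀ k : ℕ, Integrable (fun ω => |ξ ω| ^ k) P) ∧
          (∫ ω, ξ ω ∂P) = (∫ ω, μ ω ∂P) ∧
          (∫ ω, ξ ω ^ 2 ∂P) = (∫ ω, μ ω ^ 2 ∂P) + 7 / 12 * (∫ ω, D ω ^ 2 ∂P) ∧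
          (∫ ω, ξ ω ^ 3 ∂P) = (∫ ω, μ ω ^ 3 ∂P) + 7 / 4 * (∫ ω, μ ω * D ω ^ 2 ∂P) ∧
          -- three independent uniform initial points
          (α = Measure.pi (fun _ => BeautyContest.uniform01) →
            (∫ ω, ξ ω ∂P) = 1 / 2 ∧ (∫ ω, ξ ω ^ 2 ∂P) = 1 / 3 ∧ (∫ ω, ξ ω ^ 3 ∂P) = 1 / 4) ∧
          -- deterministic initial points
          (α = Measure.dirac ![1 / 4, 1 / 2, 3 / 4] →
            (∫ ω, ξ ω ∂P) = 1 / 2 ∧ (∫ ω, ξ ω ^ 2 ∂P) = 29 / 96 ∧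
            (∫ ω, ξ ω ^ 3 ∂P) = 13 / 64 ∧ (∫ ω, ξ ω ^ 4 ∂P) = 873 / 5888) := by
  have hfix := BeautyContest.limitLaw_eq_fixMap
  have hint := BeautyContest.integrable_abs_pow_limitLaw
  have hsymm := BeautyContest.map_neg_eq_of_eq_fixMap hfix
  have hodd : ∀ k : ℕ, Odd k → (∫ x, x ^ k ∂BeautyContest.limitLaw) = 0 := fun k hk =>
    BeautyContest.integral_pow_eq_zero_of_odd hsymm hk
  have θ₂ := BeautyContest.integral_sq_eq hfix hint
  have θ₄ := BeautyContest.integral_pow_four_eq hfix hint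
  refine ⟨BeautyContest.limitLaw, inferInstance, hfix,
    fun ν' _ h' => BeautyContest.eq_of_eq_fixMap h' hfix, hsymm, hint, hodd, θ₂, θ₄,
    BeautyContest.integral_pow_six_eq hfix hint, ?_⟩
  intro Ω _ P _ α _ X hα hX μ D hμ hD
  have hstat : (fun ω => (μ ω, D ω)) = fun ω => BeautyContest.coreStat (X 0 ω) := by
    rw [hμ, hD]; rfl
  have hmem := hX.ae_coreStat_mem (hα.mono fun x hx => hx.2)
  have hmeas := hX.aemeasurable_coreStat 0
  have h0 : ∫⁻ ω, ENNReal.ofReal (BeautyContest.coreStat (X 0 ω)).2 ∂P ≠ ∞ := by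
    refine ne_top_of_le_ne_top ENNReal.one_ne_top ((lintegral_mono_ae (g := fun _ => 1) ?_).trans_eq
      (by simp))
    filter_upwards [hmem] with ω hω
    exact ENNReal.ofReal_le_one.2 hω.2.2
  obtain ⟨ξ, hξ, hlim⟩ := hX.exists_limit h0
  have hlaw := hX.map_limit hfix hξ hlim
  have hρ : IsProbabilityMeasure (P.map fun ω => BeautyContest.coreStat (X 0 ω)) :=
    Measure.isProbabilityMeasure_map hmeas
  have hρmem : ∀ᵐ s ∂P.map (fun ω => BeautyContest.coreStat (X 0 ω)),
      s ∈ Set.Icc (0 : ℝ) 1 ×ˢ Set.Icc (0 : ℝ) 1 :=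
    (ae_map_iff hmeas (measurableSet_Icc.prod measurableSet_Icc)).2 hmem
  -- Independence of `L` and the initial core factors each term of the binomial expansion; the odd
  -- moments of `L` drop out below.
  have hmom : ∀ k : ℕ, ∫ ω, ξ ω ^ k ∂P = ∑ j ∈ Finset.range (k + 1), k.choose j *
      (∫ ω, μ ω ^ (k - j) * D ω ^ j ∂P) * ∫ l, l ^ j ∂BeautyContest.limitLaw := fun k => by
    rw [← integral_map (f := fun x : ℝ => x ^ k) hξ.aemeasurable (by fun_prop), hlaw,
      BeautyContest.integral_map_add_mul_pow hint hρmem]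
    refine Finset.sum_congr rfl fun j _ => ?_
    rw [integral_map hmeas (by fun_prop), hμ, hD]
    rfl
  have hval : ∀ i j : ℕ, ∫ ω, μ ω ^ i * D ω ^ j ∂P =
      ∫ s, s.1 ^ i * s.2 ^ j ∂P.map (fun ω => BeautyContest.coreStat (X 0 ω)) := fun i j => by
    rw [integral_map hmeas (by fun_prop), hμ, hD]
    rfl
  have o1 : ∫ x, x ∂BeautyContest.limitLaw = 0 := by simpa using hodd 1 odd_one
  have o3 : ∫ x, x ^ 3 ∂BeautyContest.limitLaw = 0 := hodd 3 (by decide)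
  have m1 : ∫ ω, ξ ω ∂P = ∫ ω, μ ω ∂P := by
    have h := hmom 1
    simpa [Finset.sum_range_succ, o1] using h
  have m2 : ∫ ω, ξ ω ^ 2 ∂P = (∫ ω, μ ω ^ 2 ∂P) + 7 / 12 * ∫ ω, D ω ^ 2 ∂P := by
    have h := hmom 2
    simp [Finset.sum_range_succ, o1, θ₂] at h
    linarith
  have m3 : ∫ ω, ξ ω ^ 3 ∂P = (∫ ω, μ ω ^ 3 ∂P) + 7 / 4 * ∫ ω, μ ω * D ω ^ 2 ∂P := by
    have h := hmom 3
    simp [Finset.sum_range_succ, o1, o3, θ₂, Nat.choose] at h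
    linarith
  have m4 : ∫ ω, ξ ω ^ 4 ∂P = (∫ ω, μ ω ^ 4 ∂P) + 7 / 2 * (∫ ω, μ ω ^ 2 * D ω ^ 2 ∂P) +
      375 / 368 * ∫ ω, D ω ^ 4 ∂P := by
    have h := hmom 4
    simp [Finset.sum_range_succ, o1, o3, θ₂, θ₄, Nat.choose] at h
    linarith
  have v10 := hval 1 0
  have v20 := hval 2 0
  have v02 := hval 0 2
  have v30 := hval 3 0
  have v12 := hval 1 2
  have v40 := hval 4 0
  have v22 := hval 2 2
  have v04 := hval 0 4
  simp only [pow_zero, pow_one, mul_one, one_mul] at v10 v20 v02 v30 v12 v40 v04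
  refine ⟨ξ, hξ, hlim.mono fun ω hω => BeautyContest.tendsto_core_of_tendsto_coreStat hω, ?_, ?_,
    m1, m2, m3, ?_, ?_⟩
  · rw [hstat, hlaw]
  · intro k
    have h := BeautyContest.integrable_add_mul_pow hint hρmem k
    have h' : Integrable (fun x : ℝ => |x| ^ k) (P.map ξ) := by
      rw [hlaw, integrable_map_measure (by fun_prop) (by fun_prop)]
      exact h
    exact (integrable_map_measure (by fun_prop) hξ.aemeasurable).1 h'
  · rintro rfl
    -- The four numbers are the coefficients of `h (m, d) + h (1 - m, d)`; for instance `m ^ 3 + (1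
    -- - m) ^ 3 = 1 - 3 * m + 3 * m ^ 2`, so the cubic term cancels.
    rw [hX.integral_coreStat_of_uniform_of_eq (by fun_prop) 1 0 0 0 (fun m d => by ring)] at v10
    rw [hX.integral_coreStat_of_uniform_of_eq (by fun_prop) 1 (-2) 2 0 (fun m d => by ring)] at v20
    rw [hX.integral_coreStat_of_uniform_of_eq (by fun_prop) 0 0 0 2 (fun m d => by ring)] at v02
    rw [hX.integral_coreStat_of_uniform_of_eq (by fun_prop) 1 (-3) 3 0 (fun m d => by ring)] at v30
    rw [hX.integral_coreStat_of_uniform_of_eq (by fun_prop) 0 0 0 1 (fun m d => by ring)] at v12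
    rw [m1, m2, m3, v10, v20, v02, v30, v12]
    norm_num
  · rintro rfl
    rw [hX.integral_coreStat_of_dirac] at v10 v20 v02 v30 v12 v40 v22 v04
    rw [m1, m2, m3, m4, v10, v20, v02, v30, v12, v40, v22, v04]
    norm_num
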